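/- Let $\mathbb K$ be a field with $\operatorname{char}\mathbb K\neq 2$, let $V$ be a $\mathbb K$-vector space with basis $v_1,\dots,v_n$, and let $G\subset GL(V)$ be a finite group with $\operatorname{char}\mathbb K\nmid |G|$. Write ${}^g v$ for the action of $g\in G$ on $v\in V$ and ${}^g v_j=\sum_{i=1}^n g_i^j v_i$ with $g_i^j\in\mathbb K$. Let $\mathbf q=\{q_{ij}\}_{1\le i,j\le n}$ be nonzero elements of $\mathbb K$, and let $\kappa:V\times V\to\mathbb KG$ be a bilinear map, with components $\kappa(u,w)=\sum_{g\in G}\kappa_g(u,w)\,g$, $\kappa_g(u,w)\in\mathbb K$. Let $T(V)\rtimes G$ be the skew group algebra, with multiplication $(ag)(bh)=a({}^gb)gh$ for $a,b\in T(V)$, $g,h\in G$, and let $$\hat{\mathcal H}_{\mathbf q,\kappa,1}=T(V)\rtimes G\,/\,\bigl(v_jv_i-q_{ij}v_iv_j-\kappa(v_i,v_j),\; v_i^2 \;:\; 1\le i,j\le n\bigr).$$ Let $\Lambda_{\mathbf q}(V)=\mathbb K\langle v_1,\dots,v_n \mid v_jv_i=q_{ij}v_iv_j\ (i\ne j),\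 v_i^2=0\rangle$ be the quantum exterior algebra, and put $\det_{ijkl}(g)=g_k^ig_l^j-q_{ij}\,g_l^ig_k^j$ for $g\in G$. Call $\hat{\mathcal H}_{\mathbf q,\kappa,1}$ a truncated quantum Drinfeld Hecke algebra if it has a PBW basis, that is, if the images of the monomials $v_1^{\alpha_1}v_2^{\alpha_2}\cdots v_n^{\alpha_n}g$, for $\alpha\in\{0,1\}^n$ and $g\in G$, form a $\mathbb K$-basis of it (in particular are pairwise distinct). Then $\hat{\mathcal H}_{\mathbf q,\kappa,1}$ is a truncated quantum Drinfeld Hecke algebra if and only if all of the following conditions hold: (i) the action of $G$ on $V$ extends to an action of $G$ on $\Lambda_{\mathbf q}(V)$ by algebra automorphisms, and $q_{ij}=q_{ji}^{-1}$ for all $i\neq j$; (ii) $\kappa$ is a quantum 2-form: $\kappa(v_i,v_i)=0$ and $\kappa(v_j,v_i)=-q_{ij}^{-1}\kappa(v_i,v_j)$ for all $i,j$; (iii) for all $h\in G$ and $1\le i<j<k\le n$, in $V$, $$0=(q_{ik}q_{jk}{}^hv_k-v_k)\kappa_h(v_i,v_j)+(q_{jk}v_j-q_{ij}{}^hv_j)\kappa_h(v_i,v_k)+({}^hv_i-q_{ij}q_{ik}v_i)\kappa_h(v_j,v_k);$$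 (iv) for all $g,h\in G$ and $1\le r<s\le n$, $$\kappa_{h^{-1}gh}(v_r,v_s)=\sum_{i<j}\det\nolimits_{rsij}(h)\,\kappa_g(v_i,v_j);$$ (v) for all $h\in G$ and $1\le i<j\le n$, in $V$, $$0=q_{ij}v_i\kappa_h(v_i,v_j)+{}^hv_i\kappa_h(v_i,v_j)\quad\text{and}\quad 0=q_{ij}{}^hv_j\kappa_h(v_i,v_j)+v_j\kappa_h(v_i,v_j);$$ (vi) for all $g,h\in G$ and all $1\le r\le n$, $$\sum_{i<j}g_i^rg_j^r\,\kappa_h(v_i,v_j)=0.$$ -/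

import Mathlib

namespace TruncatedQDHA

noncomputable section

section Action

variable {K V : Type*} [Field K] [AddCommGroup V] [Module K V]

/-- The action of `GL(V)` on the tensor algebra `T(V)` by algebra automorphisms that extends the
action on `V`. A subgroup of `GL(V)` acts by restriction. -/
instance glAction : MulSemiringAction (LinearMap.GeneralLinearGroup K V) (TensorAlgebra K V) where
  smul g x := TensorAlgebra.lift K (TensorAlgebra.ι K ∘ₗ (g : V →ₗ[K] V)) x
  one_smul x := by
    change TensorAlgebra.lift K (TensorAlgebra.ι K ∘ₗ
      ((1 : LinearMap.GeneralLinearGroup K V) : V →ₗ[K] V)) x = AlgHom.id K _ x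
    congr 1
    ext u
    simp
  mul_smul g h x := by
    change TensorAlgebra.lift K (TensorAlgebra.ι K ∘ₗ
        ((g * h : LinearMap.GeneralLinearGroup K V) : V →ₗ[K] V)) x =
      ((TensorAlgebra.lift K (TensorAlgebra.ι K ∘ₗ (g : V →ₗ[K] V))).comp
        (TensorAlgebra.lift K (TensorAlgebra.ι K ∘ₗ (h : V →ₗ[K] V)))) x
    congr 1
    ext u
    simp
  smul_zero _ := map_zero _
  smul_add _ := map_add _
  smul_one _ := map_one _
  smul_mul _ := map_mul _

theorem gl_smul_def (g : LinearMap.GeneralLinearGroup K V) (x : TensorAlgebra K V) :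
    g • x = TensorAlgebra.lift K (TensorAlgebra.ι K ∘ₗ (g : V →ₗ[K] V)) x := rfl

theorem gl_smul_ι (g : LinearMap.GeneralLinearGroup K V) (u : V) :
    g • TensorAlgebra.ι K u = TensorAlgebra.ι K (g • u) := by
  rw [gl_smul_def, TensorAlgebra.lift_ι_apply]
  rfl

instance glAction_smulCommClass :
    SMulCommClass (LinearMap.GeneralLinearGroup K V) K (TensorAlgebra K V) where
  smul_comm g c x := by simp only [gl_smul_def, map_smul]

end Action

section Algebras

variable {K V : Type*} [Field K] [AddCommGroup V] [Module K V] {n : ℕ}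

/-- The skew group algebra `T(V) ⋊ G`: finite sums of terms `a g` with `a ∈ T(V)`, `g ∈ G`, and the
multiplication `(a g)(b h) = a (ᵍb) gh`. -/
abbrev SkewTensor (G : Subgroup (LinearMap.GeneralLinearGroup K V)) : Type _ :=
  SkewMonoidAlgebra (TensorAlgebra K V) G

/-- A vector of `V` as an element of `T(V) ⋊ G`. -/
def vec (G : Subgroup (LinearMap.GeneralLinearGroup K V)) (u : V) : SkewTensor G :=
  SkewMonoidAlgebra.single 1 (TensorAlgebra.ι K u)

/-- The group algebra `K G` as a subalgebra of `T(V) ⋊ G`. -/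
def groupAlgebraHom (G : Subgroup (LinearMap.GeneralLinearGroup K V)) :
    MonoidAlgebra K G →ₐ[K] SkewTensor G :=
  MonoidAlgebra.lift K (SkewTensor G) G (SkewMonoidAlgebra.of (TensorAlgebra K V) G)

/-- The relators `v_j v_i - q_{ij} v_i v_j - κ(v_i, v_j)` (all `i`, `j`) and `v_i ^ 2` (all `i`). -/
inductive HeckeRel (G : Subgroup (LinearMap.GeneralLinearGroup K V)) (v : Module.Basis (Fin n) K V)
    (q : Fin n → Fin n → K) (κ : V →ₗ[K] V →ₗ[K] MonoidAlgebra K G) :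
    SkewTensor G → SkewTensor G → Prop
  | comm (i j : Fin n) : HeckeRel G v q κ
      (vec G (v j) * vec G (v i) - q i j • (vec G (v i) * vec G (v j))
        - groupAlgebraHom G (κ (v i) (v j))) 0
  | sq (i : Fin n) : HeckeRel G v q κ (vec G (v i) ^ 2) 0

/-- The algebra `T(V) ⋊ G / (v_j v_i - q_{ij} v_i v_j - κ(v_i, v_j), v_i ^ 2)`. -/
def HeckeAlgebra (G : Subgroup (LinearMap.GeneralLinearGroup K V))
    (v : Module.Basis (Fin n) K V) (q : Fin n → Fin n → K)
    (κ : V →ₗ[K] V →ₗ[K] MonoidAlgebra K G) : Type _ :=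
  RingQuot (HeckeRel G v q κ)

instance (G : Subgroup (LinearMap.GeneralLinearGroup K V))
    (v : Module.Basis (Fin n) K V) (q : Fin n → Fin n → K)
    (κ : V →ₗ[K] V →ₗ[K] MonoidAlgebra K G) : Ring (HeckeAlgebra G v q κ) :=
  inferInstanceAs (Ring (RingQuot (HeckeRel G v q κ)))

instance (G : Subgroup (LinearMap.GeneralLinearGroup K V))
    (v : Module.Basis (Fin n) K V) (q : Fin n → Fin n → K)
    (κ : V →ₗ[K] V →ₗ[K] MonoidAlgebra K G) : Algebra K (HeckeAlgebra G v q κ) :=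
  inferInstanceAs (Algebra K (RingQuot (HeckeRel G v q κ)))

/-- The quotient map. -/
def mkHecke (G : Subgroup (LinearMap.GeneralLinearGroup K V))
    (v : Module.Basis (Fin n) K V) (q : Fin n → Fin n → K)
    (κ : V →ₗ[K] V →ₗ[K] MonoidAlgebra K G) : SkewTensor G →ₐ[K] HeckeAlgebra G v q κ :=
  RingQuot.mkAlgHom K (HeckeRel G v q κ)

/-- The image of `v_1 ^ α_1 ⋯ v_n ^ α_n g` in the quotient algebra, for `α ∈ {0, 1} ^ n`, `g ∈ G`. -/
def pbwMonomial (G : Subgroup (LinearMap.GeneralLinearGroup K V))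
    (v : Module.Basis (Fin n) K V) (q : Fin n → Fin n → K)
    (κ : V →ₗ[K] V →ₗ[K] MonoidAlgebra K G) (m : (Fin n → Fin 2) × G) :
    HeckeAlgebra G v q κ :=
  mkHecke G v q κ
    ((List.ofFn fun i => vec G (v i) ^ (m.1 i : ℕ)).prod *
      SkewMonoidAlgebra.of (TensorAlgebra K V) G m.2)

/-- The quotient algebra is a truncated quantum Drinfeld Hecke algebra: the monomials
`v_1 ^ α_1 ⋯ v_n ^ α_n g` form a `K`-basis of it. -/
def IsTruncatedQDHA (G : Subgroup (LinearMap.GeneralLinearGroup K V))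
    (v : Module.Basis (Fin n) K V) (q : Fin n → Fin n → K)
    (κ : V →ₗ[K] V →ₗ[K] MonoidAlgebra K G) : Prop :=
  LinearIndependent K (pbwMonomial G v q κ) ∧
    Submodule.span K (Set.range (pbwMonomial G v q κ)) = ⊤

/-- The defining relations of the quantum exterior algebra. -/
inductive ExteriorRel (v : Module.Basis (Fin n) K V) (q : Fin n → Fin n → K) :
    TensorAlgebra K V → TensorAlgebra K V → Prop
  | comm (i j : Fin n) (hij : i ≠ j) : ExteriorRel v q
      (TensorAlgebra.ι K (v j) * TensorAlgebra.ι K (v i))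
      (q i j • (TensorAlgebra.ι K (v i) * TensorAlgebra.ι K (v j)))
  | sq (i : Fin n) : ExteriorRel v q (TensorAlgebra.ι K (v i) ^ 2) 0

/-- The quantum exterior algebra `Λ_q(V)`; the free algebra on the basis `v` is `T(V)`. -/
def QuantumExterior (v : Module.Basis (Fin n) K V) (q : Fin n → Fin n → K) : Type _ :=
  RingQuot (ExteriorRel v q)

instance (v : Module.Basis (Fin n) K V) (q : Fin n → Fin n → K) : Ring (QuantumExterior v q) :=
  inferInstanceAs (Ring (RingQuot (ExteriorRel v q)))

instance (v : Module.Basis (Fin n) K V) (q : Fin n → Fin n → K) :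
    Algebra K (QuantumExterior v q) :=
  inferInstanceAs (Algebra K (RingQuot (ExteriorRel v q)))

/-- The quotient map. -/
def mkExterior (v : Module.Basis (Fin n) K V) (q : Fin n → Fin n → K) :
    TensorAlgebra K V →ₐ[K] QuantumExterior v q :=
  RingQuot.mkAlgHom K (ExteriorRel v q)

/-- A vector of `V` as an element of `Λ_q(V)`. -/
def extVec (v : Module.Basis (Fin n) K V) (q : Fin n → Fin n → K) (u : V) :
    QuantumExterior v q :=
  mkExterior v q (TensorAlgebra.ι K u)

/-- The action of `G` on `V` extends to an action of `G` on `Λ_q(V)` by algebra automorphisms. -/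
def ActsByAutomorphisms (G : Subgroup (LinearMap.GeneralLinearGroup K V))
    (v : Module.Basis (Fin n) K V) (q : Fin n → Fin n → K) : Prop :=
  ∃ ρ : G →* (QuantumExterior v q ≃ₐ[K] QuantumExterior v q),
    ∀ (g : G) (u : V), ρ g (extVec v q u) = extVec v q (g • u)

/-- The matrix entry `g_i^j`, where `ᵍv_j = ∑ i, g_i^j v_i`. -/
def entry {G : Subgroup (LinearMap.GeneralLinearGroup K V)} (v : Module.Basis (Fin n) K V)
    (g : G) (i j : Fin n) : K :=
  v.repr (g • v j) i

/-- The quantum minor `det_{ijkl}(g) = g_k^i g_l^j - q_{ij} g_l^i g_k^j`. -/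
def quantumMinor {G : Subgroup (LinearMap.GeneralLinearGroup K V)} (v : Module.Basis (Fin n) K V)
    (q : Fin n → Fin n → K) (g : G) (i j k l : Fin n) : K :=
  entry v g k i * entry v g l j - q i j * entry v g l i * entry v g k j

/-- `κ` is a quantum 2-form. -/
def IsQuantumTwoForm {G : Subgroup (LinearMap.GeneralLinearGroup K V)}
    (v : Module.Basis (Fin n) K V) (q : Fin n → Fin n → K)
    (κ : V →ₗ[K] V →ₗ[K] MonoidAlgebra K G) : Prop :=
  ∀ i j, κ (v i) (v i) = 0 ∧ κ (v j) (v i) = -(q i j)⁻¹ • κ (v i) (v j)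

/-- The scalar `κ_g(v_i, v_j)`, where `κ(v_i, v_j) = ∑ g, κ_g(v_i, v_j) g`. -/
def kappaCoeff {G : Subgroup (LinearMap.GeneralLinearGroup K V)} (v : Module.Basis (Fin n) K V)
    (κ : V →ₗ[K] V →ₗ[K] MonoidAlgebra K G) (g : G) (i j : Fin n) : K :=
  (κ (v i) (v j)).coeff g

end Algebras

end

end TruncatedQDHA

open TruncatedQDHA

/-! Necessity is a comparison of coefficients. In the quotient, each `κ(v_i, v_j)` is a twisted
commutator, so associativity of the overlaps `v_k v_j v_i`, `v_j v_i v_i` and `v_j v_j v_i` gives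
linear identities, and conjugating the relators by a group element gives quadratic ones. The PBW
basis allows coefficients to be read off (`IsTruncatedQDHA.linear_eq_zero`,
`IsTruncatedQDHA.quadratic_eq_zero`), which yields the conditions. Condition (i) is handled through
equivalent equations on matrix entries (`preservesExteriorRel_iff`).

Sufficiency rests on a rigidity statement, `HeckeConditions.smul_eq`. Let `Q` be `q` with diagonal
entries `-1`. If `κ_x(v_a, v_i) ≠ 0` with `a < i`, then (v) and (iii) force `x` to act diagonally,
`x v_c = Q_{ca} Q_{ci} v_c`; by (iv), `x` then commutes with the values of `κ` up to explicit
scalars.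

The algebra can therefore be modelled by quantum Clifford operators on the exterior algebra with
coefficients in `K G`. The generator `v_i` acts as creation plus contractions `t_i d_a κ(v_a, v_i)`
over `a < i`, where `t_i` is a torus operator. Diagonality makes `t_a t_i x` the correct action of
such an `x`, and `QuantumWeyl.clifford_mul_clifford` gives the Hecke relations. Only the tensor
algebra has to act: the linear map `a g ↦ a · (1 ⊗ g)` kills the two-sided ideal of relators
(`HeckeConditions.orbitMap_rel`), because conditions (i), (iv) and (vi) let a group element be moved
across a relator. It sends the ordered monomials to distinct basis vectors (`prod_genOp_vacuum`), so
they are independent.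

They span by straightening words (`DiagonalSupport.span_pbwMonomial`): diagonality ensures that the
lower-order terms do not bring back unordered words. -/

namespace TruncatedQDHA

noncomputable section

open scoped TensorProduct

/-! ### Creation, removal and torus operators on the quantum exterior algebra. -/

section Fock

variable {K ι : Type*} [Field K] [LinearOrder ι]

/-- Left multiplication by the `i`-th generator on the quantum exterior algebra, in the basis of
ordered monomials indexed by finite sets. -/
def creation (q : ι → ι → K) (i : ι) : Module.End K (Finset ι →₀ K) :=
  Finsupp.linearCombination K fun A =>
    if i ∈ A then 0 else Finsupp.single (insert i A) (∏ b ∈ A, if b < i then q b i else 1)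

/-- Removal of the `i`-th generator from the right. -/
def removal (q : ι → ι → K) (i : ι) : Module.End K (Finset ι →₀ K) :=
  Finsupp.linearCombination K fun A =>
    if i ∈ A then
      Finsupp.single (A.erase i) (∏ b ∈ A.erase i, if i < b then q b i else 1) else 0

/-- The diagonal operator scaling the generator `b` by `q b i`. -/
def torus (q : ι → ι → K) (i : ι) : Module.End K (Finset ι →₀ K) :=
  Finsupp.linearCombination K fun A => Finsupp.single A (∏ b ∈ A, q b i)

theorem creation_single_of_mem (q : ι → ι → K) {i : ι} {A : Finset ι} (hi : i ∈ A) (c : K) :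
    creation q i (Finsupp.single A c) = 0 := by
  simp [creation, Finsupp.linearCombination_single, hi]

theorem creation_single (q : ι → ι → K) {i : ι} {A : Finset ι} (hi : i ∉ A) (c : K) :
    creation q i (Finsupp.single A c) =
      Finsupp.single (insert i A) (c * ∏ b ∈ A, if b < i then q b i else 1) := by
  simp [creation, Finsupp.linearCombination_single, hi]

theorem removal_single (q : ι → ι → K) {i : ι} {A : Finset ι} (hi : i ∉ A) (c : K) :
    removal q i (Finsupp.single A c) = 0 := by
  simp [removal, Finsupp.linearCombination_single, hi]

theorem removal_single_insert (q : ι → ι → K) {i : ι} {A : Finset ι} (hi : i ∉ A) (c : K) :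
    removal q i (Finsupp.single (insert i A) c) =
      Finsupp.single A (c * ∏ b ∈ A, if i < b then q b i else 1) := by
  simp [removal, Finsupp.linearCombination_single, hi]

theorem torus_single (q : ι → ι → K) (i : ι) (A : Finset ι) (c : K) :
    torus q i (Finsupp.single A c) = Finsupp.single A (c * ∏ b ∈ A, q b i) := by
  simp [torus, Finsupp.linearCombination_single]

variable {q : ι → ι → K}

theorem creation_mul_creation (hq : ∀ i j, q i j * q j i = 1) (i j : ι) :
    creation q j * creation q i = q i j • (creation q i * creation q j) := by
  refine Finsupp.lhom_ext fun A c => ?_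
  simp only [Module.End.mul_apply, LinearMap.smul_apply]
  by_cases hi : i ∈ A
  · rw [creation_single_of_mem q hi, map_zero]
    by_cases hj : j ∈ A
    · rw [creation_single_of_mem q hj, map_zero, smul_zero]
    · rw [creation_single q hj, creation_single_of_mem q (Finset.mem_insert_of_mem hi), smul_zero]
  by_cases hj : j ∈ A
  · rw [creation_single_of_mem q hj, map_zero, creation_single q hi,
      creation_single_of_mem q (Finset.mem_insert_of_mem hj), smul_zero]
  rw [creation_single q hi, creation_single q hj]
  rcases eq_or_ne i j with rfl | hij
  · rw [creation_single_of_mem q (Finset.mem_insert_self _ _), smul_zero]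
  rw [creation_single q (by simp [hj, hij.symm]), creation_single q (by simp [hi, hij]),
    Finset.prod_insert hi, Finset.prod_insert hj, Finset.insert_comm, Finsupp.smul_single]
  congr 1
  rcases hij.lt_or_gt with h | h
  · simp only [h, if_true, h.not_gt, if_false, smul_eq_mul]
    ring
  · simp only [h, if_true, h.not_gt, if_false, smul_eq_mul]
    linear_combination (-c * (∏ b ∈ A, if b < i then q b i else 1) *
      ∏ b ∈ A, if b < j then q b j else 1) * hq i j

theorem removal_mul_removal (hq : ∀ i j, q i j * q j i = 1) (a b : ι) :
    removal q a * removal q b = q a b • (removal q b * removal q a) := by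
  refine Finsupp.lhom_ext fun A c => ?_
  simp only [Module.End.mul_apply, LinearMap.smul_apply]
  by_cases ha : a ∈ A
  · obtain ⟨B, haB, rfl⟩ : ∃ B, a ∉ B ∧ insert a B = A :=
      ⟨A.erase a, Finset.notMem_erase _ _, Finset.insert_erase ha⟩
    rw [removal_single_insert q haB]
    rcases eq_or_ne a b with rfl | hab
    · rw [removal_single_insert q haB, removal_single q haB, smul_zero]
    by_cases hb : b ∈ B
    · obtain ⟨D, hbD, rfl⟩ : ∃ D, b ∉ D ∧ insert b D = B :=
        ⟨B.erase b, Finset.notMem_erase _ _, Finset.insert_erase hb⟩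
      have haD : a ∉ D := fun h => haB (Finset.mem_insert_of_mem h)
      rw [removal_single_insert q hbD, Finset.insert_comm, removal_single_insert q
        (by simp [hab.symm, hbD]), removal_single_insert q haD, Finset.prod_insert hbD,
        Finset.prod_insert haD, Finsupp.smul_single]
      congr 1
      rcases hab.lt_or_gt with h | h
      · simp only [h, if_true, h.not_gt, if_false, smul_eq_mul]
        linear_combination (-c * (∏ x ∈ D, if a < x then q x a else 1) *
          ∏ x ∈ D, if b < x then q x b else 1) * hq a b
      · simp only [h, if_true, h.not_gt, if_false, smul_eq_mul]
        ring
    · rw [removal_single q hb, removal_single q (by simp [hab.symm, hb]), map_zero, smul_zero]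
  · rw [removal_single q ha, map_zero, smul_zero]
    by_cases hb : b ∈ A
    · obtain ⟨B, hbB, rfl⟩ : ∃ B, b ∉ B ∧ insert b B = A :=
        ⟨A.erase b, Finset.notMem_erase _ _, Finset.insert_erase hb⟩
      rw [removal_single_insert q hbB, removal_single q fun h => ha (Finset.mem_insert_of_mem h)]
    · rw [removal_single q hb, map_zero]

theorem torus_mul_creation (i j : ι) :
    torus q i * creation q j = q j i • (creation q j * torus q i) := by
  refine Finsupp.lhom_ext fun A c => ?_
  simp only [Module.End.mul_apply, LinearMap.smul_apply, torus_single]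
  by_cases hj : j ∈ A
  · simp only [creation_single_of_mem q hj, map_zero, smul_zero]
  · rw [creation_single q hj, creation_single q hj, torus_single, Finset.prod_insert hj,
      Finsupp.smul_single, smul_eq_mul]
    congr 1
    ring

theorem removal_mul_torus (i j : ι) :
    removal q j * torus q i = q j i • (torus q i * removal q j) := by
  refine Finsupp.lhom_ext fun A c => ?_
  simp only [Module.End.mul_apply, LinearMap.smul_apply, torus_single]
  by_cases hj : j ∈ A
  · obtain ⟨B, hB, rfl⟩ : ∃ B, j ∉ B ∧ insert j B = A :=
      ⟨A.erase j, Finset.notMem_erase _ _, Finset.insert_erase hj⟩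
    rw [removal_single_insert q hB, removal_single_insert q hB, torus_single,
      Finset.prod_insert hB, Finsupp.smul_single, smul_eq_mul]
    congr 1
    ring
  · simp only [removal_single q hj, map_zero, smul_zero]

theorem torus_mul_torus (i j : ι) : torus q i * torus q j = torus q j * torus q i := by
  refine Finsupp.lhom_ext fun A c => ?_
  simp only [Module.End.mul_apply, torus_single]
  congr 1
  ring

/-- For `a = i`, creation collects the factors with `b < i` and removal those with `i < b`, which
together form the torus scalar. On monomials already containing `i`, the two terms on the right must
cancel; this is where `q i i = -1` enters. -/
theorem removal_mul_creation (hq : ∀ i j, q i j * q j i = 1) (hd : ∀ i, q i i = -1) (a i : ι) :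
    removal q a * creation q i =
      creation q i * removal q a + if a = i then torus q i else 0 := by
  refine Finsupp.lhom_ext fun A c => ?_
  simp only [Module.End.mul_apply, LinearMap.add_apply]
  rcases eq_or_ne a i with rfl | hai
  · rw [if_pos rfl, torus_single]
    have key : ∀ B : Finset ι, a ∉ B → (∏ b ∈ B, if b < a then q b a else 1) *
        (∏ b ∈ B, if a < b then q b a else 1) = ∏ b ∈ B, q b a := by
      intro B hB
      rw [← Finset.prod_mul_distrib]
      refine Finset.prod_congr rfl fun b hb => ?_
      rcases (ne_of_mem_of_not_mem hb hB).lt_or_gt with h | h <;> simp [h, h.not_gt]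
    by_cases ha : a ∈ A
    · obtain ⟨B, hB, rfl⟩ : ∃ B, a ∉ B ∧ insert a B = A :=
        ⟨A.erase a, Finset.notMem_erase _ _, Finset.insert_erase ha⟩
      rw [creation_single_of_mem q ha, map_zero, removal_single_insert q hB, creation_single q hB,
        Finset.prod_insert hB, ← key B hB, ← Finsupp.single_add, hd, eq_comm,
        Finsupp.single_eq_zero]
      ring
    · rw [removal_single q ha, map_zero, zero_add, creation_single q ha,
        removal_single_insert q ha, mul_assoc, key A ha]
  · rw [if_neg hai, LinearMap.zero_apply, add_zero]
    by_cases ha : a ∈ A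
    · obtain ⟨B, hB, rfl⟩ : ∃ B, a ∉ B ∧ insert a B = A :=
        ⟨A.erase a, Finset.notMem_erase _ _, Finset.insert_erase ha⟩
      rw [removal_single_insert q hB]
      by_cases hi : i ∈ B
      · rw [creation_single_of_mem q hi, creation_single_of_mem q (Finset.mem_insert_of_mem hi),
          map_zero]
      · rw [creation_single q hi, creation_single q (by simp [hai.symm, hi]), Finset.insert_comm,
          removal_single_insert q (by simp [hai, hB]), Finset.prod_insert hB,
          Finset.prod_insert hi]
        congr 1
        rcases hai.lt_or_gt with h | h
        · simp only [h, if_true]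
          linear_combination (c * (∏ b ∈ B, if b < i then q b i else 1) *
            ∏ b ∈ B, if a < b then q b a else 1) * hq a i
        · simp only [h.not_gt, if_false]
          ring
    · rw [removal_single q ha, map_zero]
      by_cases hi : i ∈ A
      · rw [creation_single_of_mem q hi, map_zero]
      · rw [creation_single q hi, removal_single q (by simp [hai, ha])]

end Fock

/-! ### Formal Clifford calculus from quantum Weyl relations. -/

section Weyl

variable {K ι C : Type*} [Field K] [DecidableEq ι] [Ring C] [Algebra K C]

/-- Operators on the quantum exterior algebra together with elements `k a i` acting on the
coefficients, with the commutation relations that make `clifford` satisfy Hecke relations. -/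
structure QuantumWeyl (q : ι → ι → K) (e d t : ι → C) (k : ι → ι → C) : Prop where
  inv : ∀ i j, q i j * q j i = 1
  ee : ∀ i j, e j * e i = q i j • (e i * e j)
  dd : ∀ a b, d a * d b = q a b • (d b * d a)
  te : ∀ i j, t i * e j = q j i • (e j * t i)
  dt : ∀ i j, d j * t i = q j i • (t i * d j)
  tt : ∀ i j, t i * t j = t j * t i
  de : ∀ a i, d a * e i = e i * d a + if a = i then t i else 0
  ke : ∀ a i j, k a i * e j = e j * k a i
  kd : ∀ a i j, k a i * d j = d j * k a i
  kt : ∀ a i j, k a i * t j = t j * k a i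
  kk : ∀ a i b j, k a i * k b j = (q b a * q b i * q j a * q j i) • (k b j * k a i)

/-- Left multiplication by the `i`-th generator: creation plus contraction. -/
def clifford [Fintype ι] (e d t : ι → C) (k : ι → ι → C) (i : ι) : C :=
  e i + ∑ a, t i * d a * k a i

variable {q : ι → ι → K} {e d t : ι → C} {k : ι → ι → C}

theorem QuantumWeyl.contraction_creation (H : QuantumWeyl q e d t k) (a i j : ι) :
    t i * d a * k a i * e j = q j i • (e j * (t i * d a * k a i)) +
      if a = j then t i * t j * k a i else 0 := by
  rw [mul_assoc, H.ke, ← mul_assoc, mul_assoc (t i), H.de, mul_add, add_mul, ← mul_assoc, H.te]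
  split_ifs <;> simp [mul_assoc]

theorem QuantumWeyl.creation_contraction (H : QuantumWeyl q e d t k) (a i j : ι) :
    e j * (t i * d a * k a i) = q i j • (t i * d a * k a i * e j) -
      if a = j then q i j • (t i * t j * k a i) else 0 := by
  rw [H.contraction_creation, smul_add, smul_smul, H.inv, one_smul]
  split_ifs <;> simp

/-- The scalar in `kk` is exactly the one for which the factors from moving `d` past `t`, `d` past
`d` and `k` past `k` collapse to `q i j`. -/
theorem QuantumWeyl.contraction_contraction (H : QuantumWeyl q e d t k) (a b i j : ι) :
    (t j * d b * k b j) * (t i * d a * k a i) =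
      q i j • ((t i * d a * k a i) * (t j * d b * k b j)) := by
  have h : ∀ a b i j, (t j * d b * k b j) * (t i * d a * k a i) =
      q b i • (t i * t j * (d b * d a) * (k b j * k a i)) := by
    intro a b i j
    calc (t j * d b * k b j) * (t i * d a * k a i)
        = t j * (d b * (k b j * t i)) * d a * k a i := by simp only [mul_assoc]
      _ = t j * (d b * t i) * (k b j * d a) * k a i := by rw [H.kt]; simp only [mul_assoc]
      _ = q b i • ((t j * t i) * (d b * d a) * (k b j * k a i)) := by
        rw [H.kd, H.dt]; simp only [mul_assoc, smul_mul_assoc, mul_smul_comm]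
      _ = _ := by rw [H.tt j i]
  rw [h, h b a j i, H.tt j i, H.dd a b, H.kk a i b j]
  simp only [smul_mul_assoc, mul_smul_comm, smul_smul]
  congr 1
  linear_combination (-q b i * q a j * q j a * q a b * q b a) * H.inv i j
    - (q b i * q a b * q b a) * H.inv a j - q b i * H.inv a b

/-- Creation with creation and contraction with contraction commute up to `q i j`. The only defect
comes from the mixed products, where the inhomogeneous part of `de` selects the summands `a = i` and
`a = j`. -/
theorem QuantumWeyl.clifford_mul_clifford [Fintype ι] (H : QuantumWeyl q e d t k) (i j : ι) :
    clifford e d t k j * clifford e d t k i =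
      q i j • (clifford e d t k i * clifford e d t k j) + t i * t j * (k i j - q i j • k j i) := by
  have h1 : e j * ∑ a, t i * d a * k a i = q i j • ((∑ a, t i * d a * k a i) * e j) -
      q i j • (t i * t j * k j i) := by
    simp only [Finset.mul_sum, Finset.sum_mul, H.creation_contraction, Finset.smul_sum,
      Finset.sum_sub_distrib, Finset.sum_ite_eq', Finset.mem_univ, if_true]
  have h2 : (∑ a, t j * d a * k a j) * e i = q i j • (e i * ∑ a, t j * d a * k a j) +
      t i * t j * k i j := by
    simp only [Finset.mul_sum, Finset.sum_mul, H.contraction_creation, Finset.smul_sum,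
      Finset.sum_add_distrib, Finset.sum_ite_eq', Finset.mem_univ, if_true, H.tt j i]
  have h3 : (∑ a, t j * d a * k a j) * (∑ a, t i * d a * k a i) =
      q i j • ((∑ a, t i * d a * k a i) * ∑ a, t j * d a * k a j) := by
    rw [Finset.sum_mul_sum, Finset.sum_mul_sum, Finset.sum_comm]
    simp only [Finset.smul_sum]
    exact Finset.sum_congr rfl fun a _ => Finset.sum_congr rfl fun b _ =>
      H.contraction_contraction a b i j
  simp only [clifford, add_mul, mul_add, H.ee i j, h1, h2, h3, smul_add, mul_sub, mul_smul_comm]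
  abel

/-- A coefficient acting through the torus operators `t a * t i` commutes with the generators up to
scalars. -/
theorem QuantumWeyl.torus_mul_clifford [Fintype ι] (H : QuantumWeyl q e d t k) {X : C} (a i : ι)
    (he : ∀ j, X * e j = e j * X) (hd : ∀ j, X * d j = d j * X) (ht : ∀ j, X * t j = t j * X)
    (hk : ∀ b j, X * k b j = (q b a * q b i * q j a * q j i) • (k b j * X)) (c : ι) :
    t a * t i * X * clifford e d t k c =
      (q c a * q c i) • (clifford e d t k c * (t a * t i * X)) := by
  have h1 : t a * t i * X * e c = (q c a * q c i) • (e c * (t a * t i * X)) := by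
    rw [mul_assoc, he, ← mul_assoc, mul_assoc (t a), H.te, mul_smul_comm, ← mul_assoc, H.te]
    simp only [smul_mul_assoc, smul_smul, mul_assoc]
    rw [mul_comm]
  have td : ∀ i j, t i * d j = q i j • (d j * t i) := fun i j => by
    rw [H.dt, smul_smul, H.inv, one_smul]
  -- Passing `d b` contributes the inverse of `q b a * q b i`, which cancels part of the scalar of
  -- `k b c`; so a contraction scales by the same factor as the creation `e c`.
  have h2 : ∀ b, t a * t i * X * (t c * d b * k b c) =
      (q c a * q c i) • (t c * d b * k b c * (t a * t i * X)) := by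
    intro b
    calc t a * t i * X * (t c * d b * k b c)
        = t a * t i * (X * t c) * d b * k b c := by simp only [mul_assoc]
      _ = t a * (t i * t c) * (X * d b) * k b c := by rw [ht]; simp only [mul_assoc]
      _ = (t a * t c) * (t i * d b) * (X * k b c) := by rw [hd, H.tt i c]; simp only [mul_assoc]
      _ = (q b a * q b i * q c a * q c i * q i b) •
            (t c * (t a * d b) * (t i * k b c) * X) := by
        rw [hk, H.tt a c, td]
        simp only [mul_assoc, smul_mul_assoc, mul_smul_comm, smul_smul]
      _ = (q b a * q b i * q c a * q c i * q i b * q a b) •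
            (t c * d b * (t a * k b c) * t i * X) := by
        rw [td, ← H.kt]
        simp only [mul_assoc, smul_mul_assoc, mul_smul_comm, smul_smul]
      _ = _ := by
        rw [← H.kt]
        simp only [mul_assoc]
        congr 1
        linear_combination (q c a * q c i * q i b * q b i) * H.inv b a
          + (q c a * q c i) * H.inv b i
  simp only [clifford, mul_add, add_mul, h1, Finset.mul_sum, Finset.sum_mul, h2, smul_add,
    Finset.smul_sum]

end Weyl

/-! ### The Clifford representation of the tensor algebra on the Fock module. -/

section Representation

variable {K V : Type*} [Field K] [AddCommGroup V] [Module K V] {n : ℕ}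
  {G : Subgroup (LinearMap.GeneralLinearGroup K V)}

/-- The quantum exterior algebra with coefficients in the group algebra. -/
abbrev FockModule (n : ℕ) (G : Subgroup (LinearMap.GeneralLinearGroup K V)) : Type _ :=
  (Finset (Fin n) →₀ K) ⊗[K] MonoidAlgebra K G

instance : AddCommGroup (FockModule n G) := Module.addCommMonoidToAddCommGroup K

/-- An operator on the quantum exterior algebra, extended to `FockModule`. -/
def fockOp (n : ℕ) (G : Subgroup (LinearMap.GeneralLinearGroup K V)) :
    Module.End K (Finset (Fin n) →₀ K) →ₐ[K] Module.End K (FockModule n G) :=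
  Module.End.rTensorAlgHom K _ _

/-- Left multiplication by an element of the group algebra on the coefficients of `FockModule`. -/
def coeffOp (n : ℕ) (G : Subgroup (LinearMap.GeneralLinearGroup K V)) :
    MonoidAlgebra K G →ₐ[K] Module.End K (FockModule n G) :=
  (Module.End.lTensorAlgHom K _ _).comp (Algebra.lmul K (MonoidAlgebra K G))

theorem fockOp_tmul (f : Module.End K (Finset (Fin n) →₀ K)) (x : Finset (Fin n) →₀ K)
    (b : MonoidAlgebra K G) : fockOp n G f (x ⊗ₜ b) = f x ⊗ₜ b := rfl

theorem coeffOp_tmul (c : MonoidAlgebra K G) (x : Finset (Fin n) →₀ K)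
    (b : MonoidAlgebra K G) : coeffOp n G c (x ⊗ₜ b) = x ⊗ₜ (c * b) := rfl

theorem coeffOp_mul_fockOp (c : MonoidAlgebra K G) (f : Module.End K (Finset (Fin n) →₀ K)) :
    coeffOp n G c * fockOp n G f = fockOp n G f * coeffOp n G c := by
  refine TensorProduct.ext' fun x b => ?_
  simp only [Module.End.mul_apply, fockOp_tmul, coeffOp_tmul]

/-- The part of `κ` above the diagonal. -/
def upper (v : Module.Basis (Fin n) K V) (κ : V →ₗ[K] V →ₗ[K] MonoidAlgebra K G) (a i : Fin n) :
    MonoidAlgebra K G :=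
  if a < i then κ (v a) (v i) else 0

/-- Group elements in the support of `κ(v_a, v_i)`, `a < i`, act diagonally on `V`, and commute with
all values of `κ` up to scalars. -/
structure DiagonalSupport (v : Module.Basis (Fin n) K V) (Q : Fin n → Fin n → K)
    (κ : V →ₗ[K] V →ₗ[K] MonoidAlgebra K G) : Prop where
  inv : ∀ i j, Q i j * Q j i = 1
  diag : ∀ i, Q i i = -1
  smul_eq : ∀ (x : G) (a i : Fin n), a < i → kappaCoeff v κ x a i ≠ 0 →
    ∀ c, x • v c = (Q c a * Q c i) • v c
  single_mul : ∀ (x : G) (a i : Fin n), a < i → kappaCoeff v κ x a i ≠ 0 → ∀ b j, b < j →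
    MonoidAlgebra.single x 1 * κ (v b) (v j) =
      (Q b a * Q b i * Q j a * Q j i) • (κ (v b) (v j) * MonoidAlgebra.single x 1)

variable {v : Module.Basis (Fin n) K V} {Q : Fin n → Fin n → K}
  {κ : V →ₗ[K] V →ₗ[K] MonoidAlgebra K G}

theorem DiagonalSupport.single_mul_upper (H : DiagonalSupport v Q κ) {x : G} {a i : Fin n}
    (hai : a < i) (hx : kappaCoeff v κ x a i ≠ 0) (b j : Fin n) :
    MonoidAlgebra.single x 1 * upper v κ b j =
      (Q b a * Q b i * Q j a * Q j i) • (upper v κ b j * MonoidAlgebra.single x 1) := by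
  rw [upper]
  split_ifs with h
  · exact H.single_mul x a i hai hx b j h
  · simp

theorem eq_sum_smul_single [Fintype G] (c : MonoidAlgebra K G) :
    c = ∑ x, c.coeff x • MonoidAlgebra.single x 1 := by
  classical
  apply MonoidAlgebra.coeff_injective
  ext y
  simp [MonoidAlgebra.coeff_sum]

theorem DiagonalSupport.upper_mul_upper [Finite G] (H : DiagonalSupport v Q κ)
    (a i b j : Fin n) :
    upper v κ a i * upper v κ b j =
      (Q b a * Q b i * Q j a * Q j i) • (upper v κ b j * upper v κ a i) := by
  have := Fintype.ofFinite G
  by_cases hai : a < i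
  · have h : ∀ x : G, kappaCoeff v κ x a i • (MonoidAlgebra.single x 1 * upper v κ b j) =
        kappaCoeff v κ x a i • ((Q b a * Q b i * Q j a * Q j i) •
          (upper v κ b j * MonoidAlgebra.single x 1)) := by
      intro x
      by_cases hx : kappaCoeff v κ x a i = 0
      · rw [hx, zero_smul, zero_smul]
      · rw [H.single_mul_upper hai hx]
    have hs : upper v κ a i = ∑ x, kappaCoeff v κ x a i • MonoidAlgebra.single x 1 := by
      rw [upper, if_pos hai]
      exact eq_sum_smul_single _
    rw [hs, Finset.sum_mul, Finset.mul_sum, Finset.smul_sum]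
    refine Finset.sum_congr rfl fun x _ => ?_
    rw [smul_mul_assoc, mul_smul_comm, h, smul_comm]
  · simp [upper, hai]

theorem DiagonalSupport.quantumWeyl [Finite G] (H : DiagonalSupport v Q κ) :
    QuantumWeyl Q (fun i => fockOp n G (creation Q i)) (fun i => fockOp n G (removal Q i))
      (fun i => fockOp n G (torus Q i)) (fun a i => coeffOp n G (upper v κ a i)) where
  inv := H.inv
  ee i j := by rw [← map_mul, creation_mul_creation H.inv, map_smul, map_mul]
  dd a b := by rw [← map_mul, removal_mul_removal H.inv, map_smul, map_mul]
  te i j := by rw [← map_mul, torus_mul_creation, map_smul, map_mul]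
  dt i j := by rw [← map_mul, removal_mul_torus, map_smul, map_mul]
  tt i j := by rw [← map_mul, torus_mul_torus, map_mul]
  de a i := by
    rw [← map_mul, removal_mul_creation H.inv H.diag, map_add, map_mul]
    split_ifs <;> simp
  ke a i j := coeffOp_mul_fockOp _ _
  kd a i j := coeffOp_mul_fockOp _ _
  kt a i j := coeffOp_mul_fockOp _ _
  kk a i b j := by rw [← map_mul, H.upper_mul_upper, map_smul, map_mul]

/-- The operator by which the generator `v_i` acts on `FockModule`. -/
def genOp (v : Module.Basis (Fin n) K V) (Q : Fin n → Fin n → K)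
    (κ : V →ₗ[K] V →ₗ[K] MonoidAlgebra K G) (i : Fin n) : Module.End K (FockModule n G) :=
  clifford (fun i => fockOp n G (creation Q i)) (fun i => fockOp n G (removal Q i))
    (fun i => fockOp n G (torus Q i)) (fun a i => coeffOp n G (upper v κ a i)) i

/-- The operator by which an element of the group algebra supported on the support of
`κ(v_a, v_i)` acts on `FockModule`. -/
def twistOp (n : ℕ) (Q : Fin n → Fin n → K) (a i : Fin n) (c : MonoidAlgebra K G) :
    Module.End K (FockModule n G) :=
  fockOp n G (torus Q a) * fockOp n G (torus Q i) * coeffOp n G c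

/-- The coefficients vanish on and below the diagonal, so for `i < j` only one of the two defect
terms of the Clifford relation survives. -/
theorem DiagonalSupport.genOp_mul_genOp [Finite G] (H : DiagonalSupport v Q κ) {i j : Fin n}
    (hij : i < j) : genOp v Q κ j * genOp v Q κ i =
      Q i j • (genOp v Q κ i * genOp v Q κ j) + twistOp n Q i j (κ (v i) (v j)) := by
  rw [genOp, genOp, H.quantumWeyl.clifford_mul_clifford, twistOp]
  simp [upper, hij, hij.not_gt]

/-- With `Q i i = -1` the Clifford relation for `i = j` says that the square equals its own
negative; here characteristic different from two is essential. -/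
theorem DiagonalSupport.genOp_mul_self [Finite G] (H : DiagonalSupport v Q κ) (hK : (2 : K) ≠ 0)
    (i : Fin n) : genOp v Q κ i * genOp v Q κ i = 0 := by
  have h := H.quantumWeyl.clifford_mul_clifford i i
  simp only [upper, lt_irrefl, if_false, map_zero, smul_zero, sub_zero, mul_zero, add_zero,
    H.diag, neg_smul, one_smul] at h
  have h2 : (2 : K) • (genOp v Q κ i * genOp v Q κ i) = 0 := by
    rw [two_smul]
    exact eq_neg_iff_add_eq_zero.mp h
  exact (smul_eq_zero.mp h2).resolve_left hK

/-- The action of the tensor algebra on `FockModule`. -/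
def tensorOp (v : Module.Basis (Fin n) K V) (Q : Fin n → Fin n → K)
    (κ : V →ₗ[K] V →ₗ[K] MonoidAlgebra K G) :
    TensorAlgebra K V →ₐ[K] Module.End K (FockModule n G) :=
  TensorAlgebra.lift K (v.constr K (genOp v Q κ))

theorem tensorOp_basis (i : Fin n) :
    tensorOp v Q κ (TensorAlgebra.ι K (v i)) = genOp v Q κ i := by
  rw [tensorOp, TensorAlgebra.lift_ι_apply, Module.Basis.constr_basis]

/-- Elements in the support of `κ` act diagonally, so on generators this is the torus scaling of
Clifford operators; multiplicativity extends it to all tensors. It is the skew group relation `x z =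
(x • z) x` in the model. -/
theorem DiagonalSupport.twistOp_mul_tensorOp [Finite G] (H : DiagonalSupport v Q κ) {x : G}
    {a i : Fin n} (hai : a < i) (hx : kappaCoeff v κ x a i ≠ 0) (z : TensorAlgebra K V) :
    twistOp n Q a i (MonoidAlgebra.single x 1) * tensorOp v Q κ z =
      tensorOp v Q κ (x • z) * twistOp n Q a i (MonoidAlgebra.single x 1) := by
  induction z using TensorAlgebra.induction with
  | algebraMap r => rw [smul_algebraMap, AlgHom.commutes, Algebra.commutes]
  | ι u =>
    have hι : ∀ u : V, x • TensorAlgebra.ι K u = TensorAlgebra.ι K (x • u) :=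
      fun u => gl_smul_ι (x : LinearMap.GeneralLinearGroup K V) u
    induction v.mem_span u using Submodule.span_induction with
    | zero => simp
    | add u w _ _ hu hw => simp only [map_add, mul_add, smul_add, add_mul, hu, hw]
    | smul r u _ hu =>
      rw [map_smul, map_smul (tensorOp v Q κ) r, mul_smul_comm, hu, smul_comm x r,
        map_smul (tensorOp v Q κ) r, smul_mul_assoc]
    | mem _ hc =>
      obtain ⟨c, rfl⟩ := hc
      rw [hι, H.smul_eq x a i hai hx, map_smul, map_smul, tensorOp_basis, smul_mul_assoc]
      refine H.quantumWeyl.torus_mul_clifford a i (fun j => coeffOp_mul_fockOp _ _)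
        (fun j => coeffOp_mul_fockOp _ _) (fun j => coeffOp_mul_fockOp _ _) (fun b j => ?_) c
      rw [← map_mul, H.single_mul_upper hai hx, map_smul, map_mul]
  | mul y z hy hz => rw [map_mul, smul_mul', map_mul, ← mul_assoc, hy, mul_assoc, hz, mul_assoc]
  | add y z hy hz => rw [map_add, smul_add, map_add, mul_add, hy, hz, add_mul]

/-- The vacuum vector with coefficient `g`. -/
def vacuum (n : ℕ) (g : G) : FockModule n G :=
  Finsupp.single ∅ 1 ⊗ₜ MonoidAlgebra.single g 1

theorem twistOp_vacuum (a i : Fin n) (x g : G) :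
    twistOp n Q a i (MonoidAlgebra.single x 1) (vacuum n g) = vacuum n (x * g) := by
  simp [twistOp, vacuum, Module.End.mul_apply, fockOp_tmul, coeffOp_tmul, torus_single]

/-- The linear map `a g ↦ a · (1 ⊗ g)`. -/
def orbitMap (v : Module.Basis (Fin n) K V) (Q : Fin n → Fin n → K)
    (κ : V →ₗ[K] V →ₗ[K] MonoidAlgebra K G) : SkewTensor G →ₗ[K] FockModule n G :=
  Finsupp.lsum K (fun g => LinearMap.applyₗ (vacuum n g) ∘ₗ (tensorOp v Q κ).toLinearMap) ∘ₗ
    (SkewMonoidAlgebra.coeffLinearEquiv (S := K)).toLinearMap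

theorem orbitMap_single (g : G) (a : TensorAlgebra K V) :
    orbitMap v Q κ (SkewMonoidAlgebra.single g a) = tensorOp v Q κ a (vacuum n g) := by
  simp [orbitMap, SkewMonoidAlgebra.coeffLinearEquiv, SkewMonoidAlgebra.coeffAddEquiv]

theorem orbitMap_single_one_mul (a : TensorAlgebra K V) (z : SkewTensor G) :
    orbitMap v Q κ (SkewMonoidAlgebra.single 1 a * z) = tensorOp v Q κ a (orbitMap v Q κ z) := by
  induction z using SkewMonoidAlgebra.induction_on with
  | zero => simp
  | add y z hy hz => rw [mul_add, map_add, hy, hz, map_add, map_add]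
  | single g b =>
    rw [SkewMonoidAlgebra.single_mul_single, orbitMap_single, orbitMap_single, one_mul, one_smul,
      map_mul, Module.End.mul_apply]

/-- The whole group is given no action on the Fock module; for `x` in the support of `κ`, left
multiplication is nevertheless realised by `twistOp`, thanks to the intertwining relation and its
effect on the vacuum. -/
theorem DiagonalSupport.orbitMap_of_mul [Finite G] (H : DiagonalSupport v Q κ) {x : G}
    {a i : Fin n} (hai : a < i) (hx : kappaCoeff v κ x a i ≠ 0) (z : SkewTensor G) :
    orbitMap v Q κ (SkewMonoidAlgebra.of (TensorAlgebra K V) G x * z) =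
      twistOp n Q a i (MonoidAlgebra.single x 1) (orbitMap v Q κ z) := by
  induction z using SkewMonoidAlgebra.induction_on with
  | zero => simp
  | add y z hy hz => rw [mul_add, map_add, hy, hz, map_add, map_add]
  | single g b =>
    rw [SkewMonoidAlgebra.of_apply, SkewMonoidAlgebra.single_mul_single, orbitMap_single,
      orbitMap_single, one_mul, ← twistOp_vacuum a i, ← Module.End.mul_apply,
      ← H.twistOp_mul_tensorOp hai hx, Module.End.mul_apply]

theorem groupAlgebraHom_eq_sum [Fintype G] (c : MonoidAlgebra K G) :
    groupAlgebraHom G c = ∑ x, c.coeff x • SkewMonoidAlgebra.of (TensorAlgebra K V) G x := by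
  conv_lhs => rw [eq_sum_smul_single c]
  simp [groupAlgebraHom, MonoidAlgebra.lift_single]

theorem DiagonalSupport.orbitMap_kappa_mul [Finite G] (H : DiagonalSupport v Q κ)
    {a i : Fin n} (hai : a < i) (z : SkewTensor G) :
    orbitMap v Q κ (groupAlgebraHom G (κ (v a) (v i)) * z) =
      twistOp n Q a i (κ (v a) (v i)) (orbitMap v Q κ z) := by
  have := Fintype.ofFinite G
  have h : twistOp n Q a i (κ (v a) (v i)) = ∑ x, kappaCoeff v κ x a i •
      twistOp n Q a i (MonoidAlgebra.single x 1) := by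
    conv_lhs => rw [eq_sum_smul_single (κ (v a) (v i))]
    simp only [twistOp, map_sum, map_smul, Finset.mul_sum, mul_smul_comm, kappaCoeff]
  rw [groupAlgebraHom_eq_sum, Finset.sum_mul, map_sum, h, LinearMap.sum_apply]
  refine Finset.sum_congr rfl fun x _ => ?_
  rw [smul_mul_assoc, map_smul, LinearMap.smul_apply]
  by_cases hx : kappaCoeff v κ x a i = 0
  · rw [hx, zero_smul]
    exact (congrArg (· • _) hx).trans (zero_smul _ _)
  · rw [H.orbitMap_of_mul hai hx]
    rfl

end Representation

/-! ### Matrix-entry form of the conditions, and the diagonal action on the support of `κ`. -/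

section Conditions

variable {K V : Type*} [Field K] [AddCommGroup V] [Module K V] {n : ℕ}
  {G : Subgroup (LinearMap.GeneralLinearGroup K V)}

theorem sum_sum_eq_sum_diag_add_sum_Ioi {M : Type*} [AddCommMonoid M] (f : Fin n → Fin n → M) :
    ∑ k, ∑ l, f k l = ∑ k, f k k + ∑ k, ∑ l ∈ Finset.Ioi k, (f k l + f l k) := by
  have h : ∀ k l, f k l = (if k = l then f k l else 0) +
      ((if k < l then f k l else 0) + if l < k then f k l else 0) := by
    intro k l
    rcases lt_trichotomy k l with h | h | h
    · simp [h, h.ne, h.not_gt]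
    · simp [h]
    · simp [h, h.ne', h.not_gt]
  have hI : ∀ k : Fin n, Finset.Ioi k = Finset.univ.filter (k < ·) := fun k => by ext; simp
  conv_lhs => enter [2, k, 2, l]; rw [h]
  simp only [Finset.sum_add_distrib]
  congr 1
  · simp
  · rw [Finset.sum_comm (f := fun k l => if l < k then f k l else 0)]
    simp only [hI, Finset.sum_filter]

/-- Straightens a quadratic expression into increasing products. The lower-order term `y` is a value
of `κ` in the quotient algebra, a `twistOp` in the Fock model, and zero in the exterior algebra. -/
theorem sum_smul_mul_of_relations {B : Type*} [Semiring B] [Algebra K B] {q : Fin n → Fin n → K}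
    {x : Fin n → B} {y : Fin n → Fin n → B} (hsq : ∀ k, x k * x k = 0)
    (hcomm : ∀ k l, k < l → x l * x k = q k l • (x k * x l) + y k l) (c : Fin n → Fin n → K) :
    ∑ k, ∑ l, c k l • (x k * x l) =
      ∑ k, ∑ l ∈ Finset.Ioi k, ((c k l + q k l * c l k) • (x k * x l) + c l k • y k l) := by
  rw [sum_sum_eq_sum_diag_add_sum_Ioi]
  simp only [hsq, smul_zero, Finset.sum_const_zero, zero_add]
  refine Finset.sum_congr rfl fun k _ => Finset.sum_congr rfl fun l hl => ?_
  rw [hcomm k l (Finset.mem_Ioi.mp hl), smul_add, smul_smul, add_smul, add_assoc, mul_comm]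

theorem smul_basis_eq_sum (v : Module.Basis (Fin n) K V) (g : G) (i : Fin n) :
    g • v i = ∑ k, entry v g k i • v k :=
  (v.sum_repr _).symm

/-- Products of two transformed generators, in a basis. -/
theorem map_smul_mul_map_smul {B : Type*} [Semiring B] [Algebra K B]
    (v : Module.Basis (Fin n) K V) (x : V →ₗ[K] B) (g : G) (i j : Fin n) :
    x (g • v i) * x (g • v j) =
      ∑ k, ∑ l, (entry v g k i * entry v g l j) • (x (v k) * x (v l)) := by
  rw [smul_basis_eq_sum, smul_basis_eq_sum, map_sum, map_sum, Finset.sum_mul_sum]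
  simp only [map_smul, smul_mul_smul_comm]

theorem map_smul_mul_map_smul_eq {B : Type*} [Semiring B] [Algebra K B]
    (v : Module.Basis (Fin n) K V) (q : Fin n → Fin n → K) (x : V →ₗ[K] B) (g : G) (i j : Fin n) :
    x (g • v j) * x (g • v i) = q i j • (x (g • v i) * x (g • v j)) +
      ∑ k, ∑ l, quantumMinor v q g i j l k • (x (v k) * x (v l)) := by
  rw [map_smul_mul_map_smul, map_smul_mul_map_smul, Finset.smul_sum, ← Finset.sum_add_distrib]
  refine Finset.sum_congr rfl fun k _ => ?_
  rw [Finset.smul_sum, ← Finset.sum_add_distrib]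
  refine Finset.sum_congr rfl fun l _ => ?_
  rw [smul_smul, ← add_smul, quantumMinor]
  congr 1
  ring

/-- The equations on matrix entries saying that `G` preserves the relations of the quantum exterior
algebra. -/
structure PreservesExteriorRel (G : Subgroup (LinearMap.GeneralLinearGroup K V))
    (v : Module.Basis (Fin n) K V) (q : Fin n → Fin n → K) : Prop where
  inv : ∀ i j, i ≠ j → q i j = (q j i)⁻¹
  minor : ∀ (g : G) (i j k l : Fin n), i < j → k < l →
    quantumMinor v q g i j l k + q k l * quantumMinor v q g i j k l = 0
  sq : ∀ (g : G) (i k l : Fin n), k < l →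
    entry v g k i * entry v g l i + q k l * (entry v g l i * entry v g k i) = 0

/-- The conditions characterising truncated quantum Drinfeld Hecke algebras, with the values of `κ`
compared in the group algebra. -/
structure HeckeConditions (G : Subgroup (LinearMap.GeneralLinearGroup K V))
    (v : Module.Basis (Fin n) K V) (q : Fin n → Fin n → K)
    (κ : V →ₗ[K] V →ₗ[K] MonoidAlgebra K G) : Prop extends PreservesExteriorRel G v q where
  form : IsQuantumTwoForm v q κ
  jacobi : ∀ (h : G) (i j k : Fin n), i < j → j < k →
    0 = kappaCoeff v κ h i j • ((q i k * q j k) • (h • v k) - v k)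
      + kappaCoeff v κ h i k • (q j k • v j - q i j • (h • v j))
      + kappaCoeff v κ h j k • (h • v i - (q i j * q i k) • v i)
  conj : ∀ (g : G) (i j : Fin n), i < j →
    MonoidAlgebra.single g 1 * κ (v i) (v j) =
      (∑ k, ∑ l ∈ Finset.Ioi k, quantumMinor v q g i j k l • κ (v k) (v l)) *
        MonoidAlgebra.single g 1
  double : ∀ (h : G) (i j : Fin n), i < j →
    0 = (q i j * kappaCoeff v κ h i j) • v i + kappaCoeff v κ h i j • (h • v i) ∧
    0 = (q i j * kappaCoeff v κ h i j) • (h • v j) + kappaCoeff v κ h i j • v j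
  square : ∀ (g : G) (r : Fin n),
    ∑ i, ∑ j ∈ Finset.Ioi i, (entry v g i r * entry v g j r) • κ (v i) (v j) = 0

variable {v : Module.Basis (Fin n) K V} {q : Fin n → Fin n → K}
  {κ : V →ₗ[K] V →ₗ[K] MonoidAlgebra K G}

theorem single_mul_eq_mul_single_iff {H : Type*} [Group H] (g : H) (c d : MonoidAlgebra K H) :
    MonoidAlgebra.single g 1 * c = d * MonoidAlgebra.single g 1 ↔
      ∀ y, c.coeff (g⁻¹ * y * g) = d.coeff y := by
  -- Coefficients are compared at `y * g`, which runs over the whole group as `y` does.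
  have h : ∀ y, (MonoidAlgebra.single g 1 * c).coeff (y * g) = c.coeff (g⁻¹ * y * g) ∧
      (d * MonoidAlgebra.single g 1).coeff (y * g) = d.coeff y := by
    intro y
    rw [MonoidAlgebra.coeff_single_mul_eq_mul_coeff (g⁻¹ * y * g), one_mul,
      MonoidAlgebra.coeff_mul_single_eq_coeff_mul y, mul_one]
    · exact ⟨rfl, rfl⟩
    · simp
    · intro m _
      rw [mul_assoc, eq_inv_mul_iff_mul_eq]
  rw [← MonoidAlgebra.coeff_inj, Finsupp.ext_iff]
  refine ⟨fun H y => by rw [← (h y).1, H, (h y).2], fun H y => ?_⟩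
  rw [← inv_mul_cancel_right y g, (h _).1, H, (h _).2]

theorem conj_iff :
    (∀ (g : G) (i j : Fin n), i < j →
      MonoidAlgebra.single g 1 * κ (v i) (v j) =
        (∑ k, ∑ l ∈ Finset.Ioi k, quantumMinor v q g i j k l • κ (v k) (v l)) *
          MonoidAlgebra.single g 1) ↔
    (∀ (g h : G) (r s : Fin n), r < s →
      kappaCoeff v κ (h⁻¹ * g * h) r s =
        ∑ i, ∑ j ∈ Finset.Ioi i, quantumMinor v q h r s i j * kappaCoeff v κ g i j) := by
  simp only [single_mul_eq_mul_single_iff]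
  refine ⟨fun H g h r s hrs => ?_, fun H g i j hij y => ?_⟩
  · rw [kappaCoeff, H h r s hrs g]
    simp [MonoidAlgebra.coeff_sum, Finsupp.finsetSum_apply, kappaCoeff]
  · rw [← kappaCoeff, H y g i j hij]
    simp [MonoidAlgebra.coeff_sum, Finsupp.finsetSum_apply, kappaCoeff]

theorem square_iff :
    (∀ (g : G) (r : Fin n),
      ∑ i, ∑ j ∈ Finset.Ioi i, (entry v g i r * entry v g j r) • κ (v i) (v j) = 0) ↔
    (∀ (g h : G) (r : Fin n),
      ∑ i, ∑ j ∈ Finset.Ioi i, entry v g i r * entry v g j r * kappaCoeff v κ h i j = 0) := by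
  rw [forall_congr']
  intro g
  rw [forall_comm, forall_congr']
  intro r
  rw [← MonoidAlgebra.coeff_inj, Finsupp.ext_iff, forall_congr']
  intro h
  simp only [MonoidAlgebra.coeff_sum, Finsupp.finsetSum_apply, MonoidAlgebra.coeff_smul_apply,
    MonoidAlgebra.coeff_zero, Finsupp.zero_apply, smul_eq_mul, kappaCoeff]

/-- The parameters `q`, with diagonal entries replaced by `-1`. -/
def fermionic (q : Fin n → Fin n → K) (i j : Fin n) : K := if i = j then -1 else q i j

theorem fermionic_of_ne {i j : Fin n} (h : i ≠ j) : fermionic q i j = q i j := if_neg h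

/-- Isolates `x • v c` in a Jacobi identity. If another coefficient is nonzero, `x` is already known
to scale `v c`, and the `c`-coordinate decides; otherwise the other terms disappear and `y₁` can be
cancelled. -/
theorem HeckeConditions.smul_of_relation {x : G} {a i c : Fin n} (hac : a ≠ c) (hic : i ≠ c)
    {p r s t y₁ y₂ y₃ : K} (hy : y₁ ≠ 0)
    (h : 0 = y₁ • (p • (x • v c) - r • v c) + y₂ • s • v i + y₃ • t • v a)
    (hx : y₂ ≠ 0 ∨ y₃ ≠ 0 → ∃ μ : K, x • v c = μ • v c) : p • (x • v c) = r • v c := by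
  by_cases h' : y₂ ≠ 0 ∨ y₃ ≠ 0
  · obtain ⟨μ, hμ⟩ := hx h'
    rw [hμ] at h ⊢
    have := congrArg (fun w => v.repr w c) h
    simp [hac, hic, hy, sub_eq_zero] at this
    rw [smul_smul, this]
  · push Not at h'
    rw [h'.1, h'.2, zero_smul, zero_smul, add_zero, add_zero, eq_comm, smul_eq_zero] at h
    exact sub_eq_zero.mp (h.resolve_left hy)

theorem HeckeConditions.smul_left (H : HeckeConditions G v q κ) {x : G} {a i : Fin n} (hai : a < i)
    (hx : kappaCoeff v κ x a i ≠ 0) : x • v a = -q a i • v a := by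
  have h := (H.double x a i hai).1
  rw [mul_comm, mul_smul, ← smul_add, eq_comm, smul_eq_zero] at h
  rw [neg_smul]
  exact eq_neg_of_add_eq_zero_right (h.resolve_left hx)

theorem HeckeConditions.smul_right (H : HeckeConditions G v q κ) (hq : ∀ i j, q i j ≠ 0)
    {x : G} {a i : Fin n} (hai : a < i) (hx : kappaCoeff v κ x a i ≠ 0) :
    x • v i = -q i a • v i := by
  have h := (H.double x a i hai).2
  rw [mul_comm, mul_smul, ← smul_add, eq_comm, smul_eq_zero] at h
  rw [H.inv i a hai.ne', neg_smul, eq_neg_iff_add_eq_zero,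
    ← smul_eq_zero_iff_right (hq a i), smul_add, smul_smul (q a i), mul_inv_cancel₀ (hq a i),
    one_smul]
  exact h.resolve_left hx

/-- For `c = a` or `c = i` the eigenvalue comes from condition (v). For any other `c`, the Jacobi
identity of the sorted triple determines it, with one case for each position of `c` relative to `a <
i`. -/
theorem HeckeConditions.smul_eq (H : HeckeConditions G v q κ) (hq : ∀ i j, q i j ≠ 0)
    {x : G} {a i : Fin n} (hai : a < i) (hx : kappaCoeff v κ x a i ≠ 0) (c : Fin n) :
    x • v c = (fermionic q c a * fermionic q c i) • v c := by
  have hl := H.smul_left hai hx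
  have hr := H.smul_right hq hai hx
  have hinv : ∀ i j, i ≠ j → q i j * q j i = 1 := fun i j hij => by
    rw [H.inv i j hij, inv_mul_cancel₀ (hq j i)]
  have cancel : ∀ {p r s : K}, p * s = 1 → p • (x • v c) = r • v c → x • v c = (s * r) • v c := by
    intro p r s hps h
    rw [mul_smul, ← h, smul_smul, mul_comm, hps, one_smul]
  rcases eq_or_ne c a with rfl | hca
  · rw [hl, fermionic, if_pos rfl, fermionic_of_ne hai.ne, neg_one_mul]
  rcases eq_or_ne c i with rfl | hci
  · rw [hr, fermionic_of_ne hai.ne', fermionic, if_pos rfl, mul_neg_one]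
  rw [fermionic_of_ne hca, fermionic_of_ne hci]
  rcases hca.lt_or_gt with h | h
  · have hj := H.jacobi x c a i h hai
    rw [hl, hr] at hj
    have := HeckeConditions.smul_of_relation (x := x) (p := 1) (r := q c a * q c i)
      (s := (q c i * q a i) * (-q i a) - 1) (t := q a i + q c a * q a i) hca.symm hci.symm
      (y₂ := kappaCoeff v κ x c a) (y₃ := kappaCoeff v κ x c i) hx
      (hj.trans (by generalize x • v c = w; module)) (by
        rintro (h' | h')
        · exact ⟨_, H.smul_left h h'⟩
        · exact ⟨_, H.smul_left (h.trans hai) h'⟩)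
    rwa [one_smul] at this
  rcases hci.lt_or_gt with h' | h'
  · have hj := H.jacobi x a c i h h'
    rw [hl, hr] at hj
    have := HeckeConditions.smul_of_relation (x := x) (p := -q a c) (r := -q c i)
      (s := (q a i * q c i) * (-q i a) - 1) (t := -q a i - q a c * q a i) hca.symm hci.symm
      (y₂ := kappaCoeff v κ x a c) (y₃ := kappaCoeff v κ x c i) hx
      (hj.trans (by generalize x • v c = w; module)) (by
        rintro (h'' | h'')
        · exact ⟨_, H.smul_right hq h h''⟩
        · exact ⟨_, H.smul_left h' h''⟩)
    have := cancel (s := -q c a) (by rw [neg_mul_neg, hinv a c hca.symm]) this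
    rwa [neg_mul_neg] at this
  · have hj := H.jacobi x a i c hai h'
    rw [hl, hr] at hj
    have := HeckeConditions.smul_of_relation (x := x) (p := q a c * q i c) (r := 1)
      (s := q i c + q a i * q i a) (t := -q a i - q a i * q a c) hca.symm hci.symm
      (y₂ := kappaCoeff v κ x a c) (y₃ := kappaCoeff v κ x i c) hx
      (hj.trans (by generalize x • v c = w; module)) (by
        rintro (h'' | h'')
        · exact ⟨_, H.smul_right hq h h''⟩
        · exact ⟨_, H.smul_right hq h' h''⟩)
    have := cancel (s := q c a * q c i) (by
      rw [mul_mul_mul_comm, hinv a c hca.symm, hinv i c hci.symm, one_mul]) this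
    rwa [mul_one] at this

/-- For diagonal `x`, the only quantum minor left in the conjugation formula for `κ(v_b, v_j)` is
the product of the two eigenvalues on `v_b` and `v_j`. -/
theorem HeckeConditions.diagonalSupport (H : HeckeConditions G v q κ) (hq : ∀ i j, q i j ≠ 0) :
    DiagonalSupport v (fermionic q) κ where
  inv i j := by
    rcases eq_or_ne i j with rfl | h
    · simp [fermionic]
    · rw [fermionic_of_ne h, fermionic_of_ne h.symm, H.inv i j h, inv_mul_cancel₀ (hq j i)]
  diag i := if_pos rfl
  smul_eq x a i hai hx := H.smul_eq hq hai hx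
  single_mul x a i hai hx b j hbj := by
    have he : ∀ k l, entry v x k l = if l = k then fermionic q l a * fermionic q l i else 0 := by
      intro k l
      rw [entry, H.smul_eq hq hai hx, map_smul, v.repr_self]
      split_ifs with h <;> simp [h]
    rw [H.conj x b j hbj, Finset.sum_eq_single b, Finset.sum_eq_single j, smul_mul_assoc]
    · congr 1
      simp only [quantumMinor, he, if_true, hbj.ne, if_false]
      ring
    · intro l hl hlj
      have : b ≠ l := (Finset.mem_Ioi.mp hl).ne
      simp [quantumMinor, he, hlj.symm, this]
    · simp [hbj]
    · intro k _ hkb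
      refine Finset.sum_eq_zero fun l hl => ?_
      have hkl := Finset.mem_Ioi.mp hl
      -- The second product in the minor would need the transposed pair, which the orderings `b < j`
      -- and `k < l` exclude.
      have : ¬ (b = l ∧ j = k) := fun h => absurd (hbj.trans (h.2 ▸ hkl)) (h.1 ▸ lt_irrefl _)
      rcases not_and_or.mp this with h | h <;> simp [quantumMinor, he, hkb.symm, h]
    · simp

end Conditions

/-! ### Exponent vectors and increasing lists of indices. -/

section Monomials

variable {n : ℕ}

/-- The increasing list of indices with exponent one. -/
def supportList (α : Fin n → Fin 2) : List (Fin n) := (List.finRange n).filter fun i => α i = 1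

/-- The exponent vector of a square-free monomial. -/
def exponent (l : List (Fin n)) (i : Fin n) : Fin 2 := if i ∈ l then 1 else 0

theorem mem_supportList {α : Fin n → Fin 2} {i : Fin n} : i ∈ supportList α ↔ α i = 1 := by
  simp [supportList]

theorem pairwise_supportList (α : Fin n → Fin 2) : (supportList α).Pairwise (· < ·) :=
  (List.pairwise_lt_finRange n).filter _

theorem supportList_exponent {l : List (Fin n)} (hl : l.Pairwise (· < ·)) :
    supportList (exponent l) = l := by
  have h := pairwise_supportList (exponent l)
  refine List.Perm.eq_of_pairwise (fun a b _ _ h1 h2 => absurd h1 h2.not_gt) h hl ?_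
  rw [List.perm_ext_iff_of_nodup (h.imp ne_of_lt) (hl.imp ne_of_lt)]
  intro i
  rw [mem_supportList, exponent]
  split_ifs <;> simp_all

theorem prod_ofFn_pow {M : Type*} [Monoid M] (x : Fin n → M) (α : Fin n → Fin 2) :
    (List.ofFn fun i => x i ^ (α i : ℕ)).prod = ((supportList α).map x).prod := by
  rw [List.ofFn_eq_map, supportList]
  induction List.finRange n with
  | nil => rfl
  | cons a l ih =>
    rw [List.map_cons, List.prod_cons, ih, List.filter_cons]
    split_ifs with h
    · have : α a = 1 := by simpa using h
      simp [this]
    · have : α a = 0 := by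
        revert h
        generalize α a = b
        revert b
        decide
      simp [this]

theorem exponent_supportList (α : Fin n → Fin 2) : exponent (supportList α) = α := by
  funext i
  rw [exponent]
  simp only [mem_supportList]
  generalize α i = a
  revert a
  decide

end Monomials

/-! ### Linear independence of the PBW monomials. -/

section LinearIndependence

variable {K V : Type*} [Field K] [AddCommGroup V] [Module K V] {n : ℕ}
  {G : Subgroup (LinearMap.GeneralLinearGroup K V)}
  {v : Module.Basis (Fin n) K V} {q : Fin n → Fin n → K}
  {κ : V →ₗ[K] V →ₗ[K] MonoidAlgebra K G}

theorem vec_add (u w : V) : vec G (u + w) = vec G u + vec G w := by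
  rw [vec, map_add, SkewMonoidAlgebra.single_add]; rfl

theorem vec_smul (c : K) (u : V) : vec G (c • u) = c • vec G u := by
  rw [vec, map_smul, vec, SkewMonoidAlgebra.smul_single]

/-- `vec` as a linear map. -/
def vecHom (G : Subgroup (LinearMap.GeneralLinearGroup K V)) : V →ₗ[K] SkewTensor G where
  toFun := vec G
  map_add' := vec_add
  map_smul' := vec_smul

theorem of_mul_vec (g : G) (u : V) :
    SkewMonoidAlgebra.of (TensorAlgebra K V) G g * vec G u =
      vec G (g • u) * SkewMonoidAlgebra.of (TensorAlgebra K V) G g := by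
  rw [SkewMonoidAlgebra.of_apply, vec, vec, SkewMonoidAlgebra.single_mul_single,
    SkewMonoidAlgebra.single_mul_single, mul_one, one_mul, one_smul, mul_one, one_mul]
  congr 1
  exact gl_smul_ι (g : LinearMap.GeneralLinearGroup K V) u

theorem groupAlgebraHom_single (g : G) :
    groupAlgebraHom G (MonoidAlgebra.single g 1) =
      SkewMonoidAlgebra.of (TensorAlgebra K V) G g := by
  rw [groupAlgebraHom, MonoidAlgebra.lift_single, one_smul]

theorem orbitMap_vec_mul (Q : Fin n → Fin n → K) (u : V) (z : SkewTensor G) :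
    orbitMap v Q κ (vec G u * z) = v.constr K (genOp v Q κ) u (orbitMap v Q κ z) := by
  rw [vec, orbitMap_single_one_mul, tensorOp, TensorAlgebra.lift_ι_apply]

/-- `Φ` is only linear, so the universal property of the quotient does not apply to it directly.
Instead, agreement of `Φ` after arbitrary left and right multiplication is a ring congruence, and it
contains the relators. -/
theorem map_eq_zero_of_mkHecke_eq_zero {M : Type*} [AddCommMonoid M] [Module K M]
    (Φ : SkewTensor G →ₗ[K] M)
    (hΦ : ∀ r s, HeckeRel G v q κ r s → ∀ a b, Φ (a * r * b) = Φ (a * s * b)) {z : SkewTensor G}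
    (hz : mkHecke G v q κ z = 0) : Φ z = 0 := by
  let c : RingCon (SkewTensor G) :=
    { r := fun x y => ∀ a b, Φ (a * x * b) = Φ (a * y * b)
      iseqv := ⟨fun _ _ _ => rfl, fun h a b => (h a b).symm, fun h h' a b => (h a b).trans (h' a b)⟩
      add' := fun h h' a b => by simp only [mul_add, add_mul, map_add, h a b, h' a b]
      mul' := fun {w x y z} h h' a b => by
        have h1 := h a (y * b)
        have h2 := h' (a * x) b
        simp only [mul_assoc] at h1 h2 ⊢
        rw [h1, h2] }
  have hc : ∀ ⦃r s⦄, HeckeRel G v q κ r s → c.mk' r = c.mk' s := fun r s h =>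
    c.eq.mpr (hΦ r s h)
  have h0 : c.mk' z = c.mk' 0 := by
    rw [← RingQuot.lift_mkRingHom_apply c.mk' hc, ← RingQuot.lift_mkRingHom_apply c.mk' hc,
      ← RingQuot.mkAlgHom_coe K]
    exact congrArg _ (hz.trans (map_zero (mkHecke G v q κ)).symm)
  simpa using c.eq.mp h0 1 1

/-- Moving `g` to the right transforms both the quadratic part and `κ`. After straightening, the
minor equations remove the quadratic terms, and the remaining twist terms match the conjugation
formula (iv). -/
theorem HeckeConditions.orbitMap_comm [Finite G] (H : HeckeConditions G v q κ)
    (hq : ∀ i j, q i j ≠ 0) (hK : (2 : K) ≠ 0) {i j : Fin n} (hij : i < j) (g : G)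
    (z : SkewTensor G) :
    orbitMap v (fermionic q) κ (SkewMonoidAlgebra.of (TensorAlgebra K V) G g *
      (vec G (v j) * vec G (v i) - q i j • (vec G (v i) * vec G (v j))
        - groupAlgebraHom G (κ (v i) (v j))) * z) = 0 := by
  have D := H.diagonalSupport hq
  have hgκ : SkewMonoidAlgebra.of (TensorAlgebra K V) G g * groupAlgebraHom G (κ (v i) (v j)) =
      (∑ k, ∑ l ∈ Finset.Ioi k, quantumMinor v q g i j k l • groupAlgebraHom G (κ (v k) (v l))) *
        SkewMonoidAlgebra.of (TensorAlgebra K V) G g := by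
    rw [← groupAlgebraHom_single, ← map_mul, H.conj g i j hij, map_mul]
    simp only [map_sum, map_smul]
  have hvv : ∀ u w : V, SkewMonoidAlgebra.of (TensorAlgebra K V) G g * (vec G u * vec G w) =
      vec G (g • u) * vec G (g • w) * SkewMonoidAlgebra.of (TensorAlgebra K V) G g := by
    intro u w
    rw [← mul_assoc, of_mul_vec, mul_assoc, of_mul_vec, mul_assoc]
  rw [mul_sub, mul_sub, mul_smul_comm, hvv, hvv, hgκ, sub_mul, sub_mul, smul_mul_assoc]
  simp only [mul_assoc, map_sub, map_smul, orbitMap_vec_mul, Finset.sum_mul, map_sum,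
    smul_mul_assoc]
  have hsum : ∀ w, ∑ k, ∑ l ∈ Finset.Ioi k, quantumMinor v q g i j k l •
        orbitMap v (fermionic q) κ (groupAlgebraHom G (κ (v k) (v l)) * w) =
      (∑ k, ∑ l ∈ Finset.Ioi k, quantumMinor v q g i j k l •
        twistOp n (fermionic q) k l (κ (v k) (v l))) (orbitMap v (fermionic q) κ w) := by
    intro w
    simp only [LinearMap.sum_apply, LinearMap.smul_apply]
    exact Finset.sum_congr rfl fun k _ => Finset.sum_congr rfl fun l hl => by
      rw [D.orbitMap_kappa_mul (Finset.mem_Ioi.mp hl)]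
  rw [hsum, ← Module.End.mul_apply, ← Module.End.mul_apply, map_smul_mul_map_smul_eq v q,
    sum_smul_mul_of_relations (q := q)
      (y := fun k l => twistOp n (fermionic q) k l (κ (v k) (v l)))]
  · have : ∀ k, ∀ l ∈ Finset.Ioi k,
        quantumMinor v q g i j l k + q k l * quantumMinor v q g i j k l = 0 :=
      fun k l hl => H.minor g i j k l hij (Finset.mem_Ioi.mp hl)
    rw [Finset.sum_congr rfl fun k _ => Finset.sum_congr rfl fun l hl => by
      rw [this k l hl, zero_smul, zero_add]]
    simp
  · intro k
    rw [Module.Basis.constr_basis]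
    exact D.genOp_mul_self hK k
  · intro k l hkl
    rw [Module.Basis.constr_basis, Module.Basis.constr_basis, D.genOp_mul_genOp hkl,
      fermionic_of_ne hkl.ne]

/-- Expanding the square of `g • v i`, the matrix equations for squares remove the quadratic terms
and condition (vi) removes the `κ` terms. -/
theorem HeckeConditions.orbitMap_sq [Finite G] (H : HeckeConditions G v q κ)
    (hq : ∀ i j, q i j ≠ 0) (hK : (2 : K) ≠ 0) (i : Fin n) (g : G) (z : SkewTensor G) :
    orbitMap v (fermionic q) κ
      (SkewMonoidAlgebra.of (TensorAlgebra K V) G g * vec G (v i) ^ 2 * z) = 0 := by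
  have D := H.diagonalSupport hq
  rw [sq, ← mul_assoc, of_mul_vec, mul_assoc (vec G (g • v i)), of_mul_vec]
  simp only [mul_assoc, orbitMap_vec_mul]
  rw [← Module.End.mul_apply, map_smul_mul_map_smul,
    sum_smul_mul_of_relations (q := q)
      (y := fun k l => twistOp n (fermionic q) k l (κ (v k) (v l)))]
  · rw [Finset.sum_congr rfl fun k _ => Finset.sum_congr rfl fun l hl => by
      rw [H.sq g i k l (Finset.mem_Ioi.mp hl), zero_smul, zero_add]]
    have h := congrArg (fun c => orbitMap v (fermionic q) κ (groupAlgebraHom G c *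
      (SkewMonoidAlgebra.of (TensorAlgebra K V) G g * z))) (H.square g i)
    simp only [map_sum, map_smul, map_zero, Finset.sum_mul, smul_mul_assoc, zero_mul] at h
    rw [← h]
    simp only [LinearMap.sum_apply, LinearMap.smul_apply]
    exact Finset.sum_congr rfl fun k _ => Finset.sum_congr rfl fun l hl => by
      rw [D.orbitMap_kappa_mul (Finset.mem_Ioi.mp hl), mul_comm]
  · intro k
    rw [Module.Basis.constr_basis]
    exact D.genOp_mul_self hK k
  · intro k l hkl
    rw [Module.Basis.constr_basis, Module.Basis.constr_basis, D.genOp_mul_genOp hkl,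
      fermionic_of_ne hkl.ne]

/-- All relators follow from the squares and the relators with `i < j`. -/
theorem HeckeConditions.comm_relator (H : HeckeConditions G v q κ) (hq : ∀ i j, q i j ≠ 0)
    {i j : Fin n} (hij : i < j) :
    vec G (v i) * vec G (v j) - q j i • (vec G (v j) * vec G (v i))
        - groupAlgebraHom G (κ (v j) (v i)) =
      -(q i j)⁻¹ • (vec G (v j) * vec G (v i) - q i j • (vec G (v i) * vec G (v j))
        - groupAlgebraHom G (κ (v i) (v j))) := by
  rw [(H.form i j).2, H.inv j i hij.ne', map_smul, smul_sub, smul_sub, smul_smul, neg_mul,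
    inv_mul_cancel₀ (hq i j)]
  simp only [neg_smul, one_smul]
  abel

theorem HeckeConditions.orbitMap_rel [Finite G] (H : HeckeConditions G v q κ)
    (hq : ∀ i j, q i j ≠ 0) (hK : (2 : K) ≠ 0) {r s : SkewTensor G} (hrs : HeckeRel G v q κ r s)
    (a z : SkewTensor G) :
    orbitMap v (fermionic q) κ (a * r * z) = orbitMap v (fermionic q) κ (a * s * z) := by
  have hs : s = 0 := by cases hrs <;> rfl
  rw [hs, mul_zero, zero_mul, map_zero]
  induction a using SkewMonoidAlgebra.induction_on with
  | zero => simp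
  | add a b ha hb => rw [add_mul, add_mul, map_add, ha, hb, add_zero]
  | single g a =>
    have : SkewMonoidAlgebra.single g a = SkewMonoidAlgebra.single 1 a *
        SkewMonoidAlgebra.of (TensorAlgebra K V) G g := by
      rw [SkewMonoidAlgebra.of_apply, SkewMonoidAlgebra.single_mul_single, one_mul, one_smul,
        mul_one]
    rw [this, mul_assoc, mul_assoc, orbitMap_single_one_mul, ← mul_assoc]
    suffices h : orbitMap v (fermionic q) κ
        (SkewMonoidAlgebra.of (TensorAlgebra K V) G g * r * z) = 0 by rw [h, map_zero]
    cases hrs with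
    | sq i => exact H.orbitMap_sq hq hK i g z
    | comm i j =>
      rcases lt_trichotomy i j with h | rfl | h
      · exact H.orbitMap_comm hq hK h g z
      · rw [(H.form i i).1, map_zero, sub_zero, ← sq, mul_sub, mul_smul_comm, sub_mul,
          smul_mul_assoc, map_sub, map_smul, H.orbitMap_sq hq hK, smul_zero, sub_self]
      · rw [H.comm_relator hq h, mul_smul_comm, smul_mul_assoc, map_smul,
          H.orbitMap_comm hq hK h, smul_zero]

/-- In an increasing word each new index `a` is smaller than those present, so creation has scalar
one. A contraction could only remove some `b > a`, but its coefficient `upper v κ b a` is zero. -/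
theorem prod_genOp_vacuum (Q : Fin n → Fin n → K) {l : List (Fin n)} (hl : l.Pairwise (· < ·))
    (g : G) : (l.map (genOp v Q κ)).prod (vacuum n g) =
      Finsupp.single l.toFinset 1 ⊗ₜ MonoidAlgebra.single g 1 := by
  induction l with
  | nil => rfl
  | cons a l ih =>
    rw [List.pairwise_cons] at hl
    have ha : a ∉ l.toFinset := fun h => lt_irrefl _ (hl.1 a (List.mem_toFinset.mp h))
    rw [List.map_cons, List.prod_cons, Module.End.mul_apply, ih hl.2, genOp, clifford,
      LinearMap.add_apply, LinearMap.sum_apply, fockOp_tmul, creation_single _ ha, one_mul,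
      Finset.prod_eq_one, Finset.sum_eq_zero, add_zero, List.toFinset_cons]
    · intro b _
      rw [Module.End.mul_apply, Module.End.mul_apply, coeffOp_tmul, fockOp_tmul]
      by_cases hb : b ∈ l.toFinset
      · rw [upper, if_neg (hl.1 b (List.mem_toFinset.mp hb)).not_gt, zero_mul,
          TensorProduct.tmul_zero, map_zero]
      · rw [removal_single _ hb, TensorProduct.zero_tmul, map_zero]
    · intro b hb
      rw [if_neg (hl.1 b (List.mem_toFinset.mp hb)).not_gt]

theorem orbitMap_monomial (Q : Fin n → Fin n → K) (l : List (Fin n)) (g : G) :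
    orbitMap v Q κ ((l.map fun i => vec G (v i)).prod *
      SkewMonoidAlgebra.of (TensorAlgebra K V) G g) =
        (l.map (genOp v Q κ)).prod (vacuum n g) := by
  induction l with
  | nil =>
    rw [List.map_nil, List.prod_nil, one_mul, SkewMonoidAlgebra.of_apply, orbitMap_single, map_one]
    rfl
  | cons a l ih =>
    rw [List.map_cons, List.prod_cons, mul_assoc, orbitMap_vec_mul, ih, Module.Basis.constr_basis]
    rfl

theorem HeckeConditions.linearIndependent [Finite G] (H : HeckeConditions G v q κ)
    (hq : ∀ i j, q i j ≠ 0) (hK : (2 : K) ≠ 0) : LinearIndependent K (pbwMonomial G v q κ) := by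
  set m : (Fin n → Fin 2) × G → SkewTensor G := fun p =>
    (List.ofFn fun i => vec G (v i) ^ (p.1 i : ℕ)).prod *
      SkewMonoidAlgebra.of (TensorAlgebra K V) G p.2 with hm
  have hΦ : LinearIndependent K (orbitMap v (fermionic q) κ ∘ m) := by
    have hb := ((Finsupp.basisSingleOne (R := K) (ι := Finset (Fin n))).tensorProduct
      (MonoidAlgebra.basis G K)).linearIndependent
    have hinj : Function.Injective fun p : (Fin n → Fin 2) × G =>
        ((supportList p.1).toFinset, p.2) := by
      rintro ⟨α, g⟩ ⟨β, h⟩ hp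
      obtain ⟨h1, h2⟩ := Prod.mk.inj hp
      refine Prod.ext ?_ h2
      rw [← exponent_supportList α, ← exponent_supportList β]
      funext i
      simp only [exponent, ← List.mem_toFinset, h1]
    have he : orbitMap v (fermionic q) κ ∘ m =
        (Finsupp.basisSingleOne (R := K) (ι := Finset (Fin n))).tensorProduct
          (MonoidAlgebra.basis G K) ∘
            fun p : (Fin n → Fin 2) × G => ((supportList p.1).toFinset, p.2) := by
      funext p
      simp only [hm, Function.comp_apply]
      rw [prod_ofFn_pow, orbitMap_monomial, prod_genOp_vacuum _ (pairwise_supportList _),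
        Module.Basis.tensorProduct_apply, MonoidAlgebra.basis_apply, Finsupp.coe_basisSingleOne]
    rw [he]
    exact hb.comp _ hinj
  rw [linearIndependent_iff] at hΦ ⊢
  intro c hc
  refine hΦ c ?_
  rw [← Finsupp.apply_linearCombination]
  refine map_eq_zero_of_mkHecke_eq_zero (v := v) (q := q) (κ := κ) _
    (fun r s hrs a b => H.orbitMap_rel hq hK hrs a b) ?_
  rw [← hc]
  exact Finsupp.apply_linearCombination K (mkHecke G v q κ).toLinearMap m c

end LinearIndependence

/-! ### The PBW monomials span the quotient algebra. -/

section Quotient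

variable {K V : Type*} [Field K] [AddCommGroup V] [Module K V] {n : ℕ}
  {G : Subgroup (LinearMap.GeneralLinearGroup K V)}

/-- A vector of `V` as an element of the quotient algebra. -/
def heckeVec (v : Module.Basis (Fin n) K V) (q : Fin n → Fin n → K)
    (κ : V →ₗ[K] V →ₗ[K] MonoidAlgebra K G) : V →ₗ[K] HeckeAlgebra G v q κ :=
  (mkHecke G v q κ).toLinearMap ∘ₗ vecHom G

/-- The map from the group algebra to the quotient algebra. -/
def heckeGroup (v : Module.Basis (Fin n) K V) (q : Fin n → Fin n → K)
    (κ : V →ₗ[K] V →ₗ[K] MonoidAlgebra K G) : MonoidAlgebra K G →ₐ[K] HeckeAlgebra G v q κ :=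
  (mkHecke G v q κ).comp (groupAlgebraHom G)

/-- A word in the basis vectors followed by a group element, in the quotient algebra. -/
def heckeWord (v : Module.Basis (Fin n) K V) (q : Fin n → Fin n → K)
    (κ : V →ₗ[K] V →ₗ[K] MonoidAlgebra K G) (l : List (Fin n)) (g : G) : HeckeAlgebra G v q κ :=
  (l.map fun i => heckeVec v q κ (v i)).prod * heckeGroup v q κ (MonoidAlgebra.single g 1)

variable {v : Module.Basis (Fin n) K V} {q : Fin n → Fin n → K}
  {κ : V →ₗ[K] V →ₗ[K] MonoidAlgebra K G}

theorem heckeVec_apply (u : V) : heckeVec v q κ u = mkHecke G v q κ (vec G u) := rfl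

theorem heckeGroup_apply (c : MonoidAlgebra K G) :
    heckeGroup v q κ c = mkHecke G v q κ (groupAlgebraHom G c) := rfl

theorem heckeVec_mul_self (i : Fin n) : heckeVec v q κ (v i) * heckeVec v q κ (v i) = 0 := by
  have h := RingQuot.mkAlgHom_rel K (HeckeRel.sq (G := G) (v := v) (q := q) (κ := κ) i)
  rw [map_pow, map_zero, sq] at h
  exact h

theorem heckeVec_comm (i j : Fin n) : heckeVec v q κ (v j) * heckeVec v q κ (v i) =
    q i j • (heckeVec v q κ (v i) * heckeVec v q κ (v j)) + heckeGroup v q κ (κ (v i) (v j)) := by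
  have h := RingQuot.mkAlgHom_rel K (HeckeRel.comm (G := G) (v := v) (q := q) (κ := κ) i j)
  rw [map_sub, map_sub, map_smul, map_mul, map_mul, map_zero, sub_sub, sub_eq_zero] at h
  exact h

theorem heckeGroup_mul_heckeVec (g : G) (u : V) :
    heckeGroup v q κ (MonoidAlgebra.single g 1) * heckeVec v q κ u =
      heckeVec v q κ (g • u) * heckeGroup v q κ (MonoidAlgebra.single g 1) := by
  rw [heckeGroup_apply, groupAlgebraHom_single, heckeVec_apply, ← map_mul, of_mul_vec, map_mul]
  rfl

theorem heckeWord_cons (i : Fin n) (l : List (Fin n)) (g : G) :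
    heckeWord v q κ (i :: l) g = heckeVec v q κ (v i) * heckeWord v q κ l g := by
  rw [heckeWord, List.map_cons, List.prod_cons, mul_assoc, heckeWord]

theorem pbwMonomial_eq (p : (Fin n → Fin 2) × G) :
    pbwMonomial G v q κ p = heckeWord v q κ (supportList p.1) p.2 := by
  rw [pbwMonomial, prod_ofFn_pow, map_mul, map_list_prod, List.map_map, heckeWord,
    heckeGroup_apply, groupAlgebraHom_single]
  rfl

theorem pbwMonomial_exponent {l : List (Fin n)} (hl : l.Pairwise (· < ·)) (g : G) :
    pbwMonomial G v q κ (exponent l, g) = heckeWord v q κ l g := by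
  rw [pbwMonomial_eq, supportList_exponent hl]

/-- The span of the ordered square-free words of length at most `m`. -/
def wordSpan (v : Module.Basis (Fin n) K V) (q : Fin n → Fin n → K)
    (κ : V →ₗ[K] V →ₗ[K] MonoidAlgebra K G) (m : ℕ) : Submodule K (HeckeAlgebra G v q κ) :=
  Submodule.span K {w | ∃ (l : List (Fin n)) (g : G), l.Pairwise (· < ·) ∧ l.length ≤ m ∧
    heckeWord v q κ l g = w}

theorem heckeWord_mem_wordSpan {m : ℕ} {l : List (Fin n)} (hl : l.Pairwise (· < ·))
    (hm : l.length ≤ m) (g : G) : heckeWord v q κ l g ∈ wordSpan v q κ m :=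
  Submodule.subset_span ⟨l, g, hl, hm, rfl⟩

theorem wordSpan_le_comap {m m' : ℕ} (z : HeckeAlgebra G v q κ)
    (h : ∀ (l : List (Fin n)) (g : G), l.Pairwise (· < ·) → l.length ≤ m →
      z * heckeWord v q κ l g ∈ wordSpan v q κ m') {w : HeckeAlgebra G v q κ}
    (hw : w ∈ wordSpan v q κ m) : z * w ∈ wordSpan v q κ m' := by
  have : wordSpan v q κ m ≤ (wordSpan v q κ m').comap (LinearMap.mulLeft K z) := by
    refine Submodule.span_le.mpr ?_
    rintro _ ⟨l, g, hl, hm, rfl⟩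
    exact h l g hl hm
  exact this hw

/-- A diagonal `x` passes through each letter with a scalar, so the word itself is unchanged; a
general group element would turn it into a sum of unordered words. -/
theorem DiagonalSupport.single_mul_heckeWord {Q : Fin n → Fin n → K} (D : DiagonalSupport v Q κ)
    {x : G} {a i : Fin n} (hai : a < i) (hx : kappaCoeff v κ x a i ≠ 0) (l : List (Fin n)) (g : G) :
    ∃ c : K, heckeGroup v q κ (MonoidAlgebra.single x 1) * heckeWord v q κ l g =
      c • heckeWord v q κ l (x * g) := by
  induction l with
  | nil =>
    refine ⟨1, ?_⟩
    rw [heckeWord, heckeWord, List.map_nil, List.prod_nil, one_mul, one_mul, ← map_mul,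
      MonoidAlgebra.single_mul_single, one_mul, one_smul]
  | cons b l ih =>
    obtain ⟨c, hc⟩ := ih
    refine ⟨Q b a * Q b i * c, ?_⟩
    rw [heckeWord_cons, ← mul_assoc, heckeGroup_mul_heckeVec, D.smul_eq x a i hai hx, map_smul,
      smul_mul_assoc, smul_mul_assoc, mul_assoc, hc, mul_smul_comm, smul_smul, heckeWord_cons]

theorem DiagonalSupport.kappa_mul_heckeWord [Finite G] {Q : Fin n → Fin n → K}
    (D : DiagonalSupport v Q κ) {a i : Fin n} (hai : a < i) {m : ℕ} {l : List (Fin n)}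
    (hl : l.Pairwise (· < ·)) (hm : l.length ≤ m) (g : G) :
    heckeGroup v q κ (κ (v a) (v i)) * heckeWord v q κ l g ∈ wordSpan v q κ m := by
  have := Fintype.ofFinite G
  rw [eq_sum_smul_single (κ (v a) (v i)), map_sum, Finset.sum_mul]
  refine Submodule.sum_mem _ fun x _ => ?_
  rw [map_smul, smul_mul_assoc]
  by_cases hx : kappaCoeff v κ x a i = 0
  · rw [show (κ (v a) (v i)).coeff x = 0 from hx, zero_smul]
    exact Submodule.zero_mem _
  · obtain ⟨c, hc⟩ := D.single_mul_heckeWord (q := q) hai hx l g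
    rw [hc]
    exact Submodule.smul_mem _ _ (Submodule.smul_mem _ _ (heckeWord_mem_wordSpan hl hm _))

/-- Straightening by double induction, on length and then on the new letter. An out-of-order letter
is exchanged with the head of the word, and the `κ` term is a combination of ordered words that are
no longer than the tail. -/
theorem DiagonalSupport.heckeVec_mul_heckeWord [Finite G] {Q : Fin n → Fin n → K}
    (D : DiagonalSupport v Q κ) (m : ℕ) : ∀ (i : Fin n) (l : List (Fin n)) (g : G),
      l.Pairwise (· < ·) → l.length ≤ m →
        heckeVec v q κ (v i) * heckeWord v q κ l g ∈ wordSpan v q κ (m + 1) := by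
  induction m with
  | zero =>
    intro i l g _ hm
    rw [List.length_eq_zero_iff.mp (Nat.le_zero.mp hm), ← heckeWord_cons]
    exact heckeWord_mem_wordSpan (List.pairwise_singleton _ _) le_rfl g
  | succ m ihm =>
    intro i
    induction i using WellFoundedLT.induction with
    | ind i ihi =>
    intro l g hl hm
    rcases l with _ | ⟨a, l⟩
    · rw [← heckeWord_cons]
      exact heckeWord_mem_wordSpan (List.pairwise_singleton _ _) (by simp) g
    obtain ⟨hal, hl'⟩ := List.pairwise_cons.mp hl
    have hm' : l.length ≤ m := Nat.le_of_succ_le_succ hm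
    rcases lt_trichotomy i a with h | rfl | h
    · rw [← heckeWord_cons]
      refine heckeWord_mem_wordSpan (List.pairwise_cons.mpr ⟨fun b hb => ?_, hl⟩)
        (Nat.succ_le_succ hm) g
      rcases List.mem_cons.mp hb with rfl | hb
      · exact h
      · exact h.trans (hal b hb)
    · rw [heckeWord_cons, ← mul_assoc, heckeVec_mul_self, zero_mul]
      exact Submodule.zero_mem _
    · rw [heckeWord_cons, ← mul_assoc, heckeVec_comm, add_mul, smul_mul_assoc, mul_assoc]
      refine Submodule.add_mem _ (Submodule.smul_mem _ _ ?_)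
        (D.kappa_mul_heckeWord h hl' (by omega) g)
      -- The length induction inserts `v_i` into the shorter tail; the induction on the letter then
      -- allows multiplication by `v_a`, since `a < i`.
      exact wordSpan_le_comap _ (ihi a h) (ihm i l g hl' hm')

theorem DiagonalSupport.span_pbwMonomial [Finite G] {Q : Fin n → Fin n → K}
    (D : DiagonalSupport v Q κ) : Submodule.span K (Set.range (pbwMonomial G v q κ)) = ⊤ := by
  set W := Submodule.span K (Set.range (pbwMonomial G v q κ)) with hW
  have hword : ∀ (l : List (Fin n)) (g : G), l.Pairwise (· < ·) → heckeWord v q κ l g ∈ W :=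
    fun l g hl => Submodule.subset_span ⟨(exponent l, g), pbwMonomial_exponent hl g⟩
  have hle : ∀ m, wordSpan v q κ m ≤ W := by
    intro m
    refine Submodule.span_le.mpr ?_
    rintro _ ⟨l, g, hl, -, rfl⟩
    exact hword l g hl
  have hmul : ∀ (a : TensorAlgebra K V) (w : HeckeAlgebra G v q κ), w ∈ W →
      mkHecke G v q κ (SkewMonoidAlgebra.single 1 a) * w ∈ W := by
    intro a
    induction a using TensorAlgebra.induction with
    | algebraMap r =>
      intro w hw
      have : (SkewMonoidAlgebra.single 1 (algebraMap K (TensorAlgebra K V) r) : SkewTensor G) =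
        algebraMap K _ r := rfl
      rw [this, AlgHom.commutes, ← Algebra.smul_def]
      exact W.smul_mem r hw
    | ι u =>
      intro w hw
      change heckeVec v q κ u * w ∈ W
      induction v.mem_span u using Submodule.span_induction with
      | zero => simp
      | add u u' _ _ hu hu' => rw [map_add, add_mul]; exact W.add_mem hu hu'
      | smul r u _ hu => rw [map_smul, smul_mul_assoc]; exact W.smul_mem r hu
      | mem _ hc =>
        obtain ⟨i, rfl⟩ := hc
        have : W ≤ W.comap (LinearMap.mulLeft K (heckeVec v q κ (v i))) := by
          refine Submodule.span_le.mpr ?_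
          rintro _ ⟨p, rfl⟩
          rw [pbwMonomial_eq]
          exact hle _ (D.heckeVec_mul_heckeWord _ i _ _ (pairwise_supportList _) le_rfl)
        exact this hw
    | mul a b ha hb =>
      intro w hw
      have : (SkewMonoidAlgebra.single 1 (a * b) : SkewTensor G) =
          SkewMonoidAlgebra.single 1 a * SkewMonoidAlgebra.single 1 b := by
        rw [SkewMonoidAlgebra.single_mul_single, one_mul, one_smul]
      rw [this, map_mul, mul_assoc]
      exact ha _ (hb _ hw)
    | add a b ha hb =>
      intro w hw
      rw [SkewMonoidAlgebra.single_add, map_add, add_mul]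
      exact W.add_mem (ha w hw) (hb w hw)
  rw [eq_top_iff]
  rintro z -
  obtain ⟨z, rfl⟩ := RingQuot.mkAlgHom_surjective K (HeckeRel G v q κ) z
  change mkHecke G v q κ z ∈ W
  induction z using SkewMonoidAlgebra.induction_on with
  | zero => rw [map_zero]; exact W.zero_mem
  | add y z hy hz => rw [map_add]; exact W.add_mem hy hz
  | single g a =>
    have : (SkewMonoidAlgebra.single g a : SkewTensor G) = SkewMonoidAlgebra.single 1 a *
        groupAlgebraHom G (MonoidAlgebra.single g 1) := by
      rw [groupAlgebraHom_single, SkewMonoidAlgebra.of_apply,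
        SkewMonoidAlgebra.single_mul_single, one_mul, one_smul, mul_one]
    rw [this, map_mul]
    refine hmul a _ ?_
    have h := hword [] g List.Pairwise.nil
    rwa [heckeWord, List.map_nil, List.prod_nil, one_mul] at h

end Quotient

/-! ### Necessity: comparison of PBW coefficients. -/

section Necessity

variable {K V : Type*} [Field K] [AddCommGroup V] [Module K V] {n : ℕ}
  {G : Subgroup (LinearMap.GeneralLinearGroup K V)}
  {v : Module.Basis (Fin n) K V} {q : Fin n → Fin n → K}
  {κ : V →ₗ[K] V →ₗ[K] MonoidAlgebra K G}

/-- Coordinate functionals with respect to ordered words. -/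
theorem IsTruncatedQDHA.exists_coord (h : IsTruncatedQDHA G v q κ) {l₀ : List (Fin n)}
    (hl₀ : l₀.Pairwise (· < ·)) (g₀ : G) : ∃ f : HeckeAlgebra G v q κ →ₗ[K] K,
      f (heckeWord v q κ l₀ g₀) = 1 ∧ ∀ (l : List (Fin n)) (g : G), l.Pairwise (· < ·) →
        (l ≠ l₀ ∨ g ≠ g₀) → f (heckeWord v q κ l g) = 0 := by
  let b := Module.Basis.mk h.1 h.2.ge
  refine ⟨b.coord (exponent l₀, g₀), ?_, fun l g hl hne => ?_⟩
  · rw [← pbwMonomial_exponent hl₀]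
    exact (Module.Basis.mk_coord_apply_eq _)
  · rw [← pbwMonomial_exponent hl]
    refine Module.Basis.mk_coord_apply_ne fun he => ?_
    obtain ⟨h1, h2⟩ := Prod.mk.inj he
    rcases hne with hne | hne
    · exact hne (by rw [← supportList_exponent hl, h1, supportList_exponent hl₀])
    · exact hne h2

theorem heckeVec_mul_heckeVec_eq (i j : Fin n) :
    heckeVec v q κ (v i) * heckeVec v q κ (v j) = heckeWord v q κ [i, j] 1 := by
  rw [heckeWord_cons, heckeWord_cons, heckeWord, List.map_nil, List.prod_nil, one_mul,
    ← MonoidAlgebra.one_def, map_one, mul_one]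

theorem heckeGroup_eq_sum [Fintype G] (c : MonoidAlgebra K G) :
    heckeGroup v q κ c = ∑ x, c.coeff x • heckeWord v q κ [] x := by
  conv_lhs => rw [eq_sum_smul_single c]
  simp only [heckeWord, List.map_nil, List.prod_nil, one_mul, map_sum, map_smul]

theorem IsTruncatedQDHA.quadratic_eq_zero [Finite G] (h : IsTruncatedQDHA G v q κ)
    {c : Fin n → Fin n → K} {d : MonoidAlgebra K G}
    (hc : ∑ k, ∑ l ∈ Finset.Ioi k, c k l • (heckeVec v q κ (v k) * heckeVec v q κ (v l)) +
      heckeGroup v q κ d = 0) : (∀ k l, k < l → c k l = 0) ∧ d = 0 := by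
  have := Fintype.ofFinite G
  have hpair : ∀ {i j : Fin n}, i < j → [i, j].Pairwise (· < ·) := fun hij => by simp [hij]
  simp only [heckeVec_mul_heckeVec_eq, heckeGroup_eq_sum] at hc
  constructor
  · intro i j hij
    obtain ⟨f, hf1, hf0⟩ := h.exists_coord (hpair hij) 1
    have h2 := congrArg f hc
    rw [map_add, map_zero, map_sum, map_sum, Finset.sum_eq_single i, map_sum,
      Finset.sum_eq_single j, map_smul, hf1, Finset.sum_eq_zero, add_zero, smul_eq_mul,
      mul_one] at h2
    · exact h2
    · intro x _
      rw [map_smul, hf0 _ _ List.Pairwise.nil (Or.inl (by simp)), smul_zero]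
    · intro l hl hne
      rw [map_smul, hf0 _ _ (hpair (Finset.mem_Ioi.mp hl)) (Or.inl (by simp [hne])), smul_zero]
    · simp [hij]
    · intro k _ hne
      rw [map_sum]
      refine Finset.sum_eq_zero fun l hl => ?_
      rw [map_smul, hf0 _ _ (hpair (Finset.mem_Ioi.mp hl)) (Or.inl (by simp [hne])), smul_zero]
    · simp
  · apply MonoidAlgebra.coeff_injective
    ext x
    obtain ⟨f, hf1, hf0⟩ := h.exists_coord List.Pairwise.nil x
    have h2 := congrArg f hc
    rw [map_add, map_zero, map_sum, map_sum, Finset.sum_eq_zero, zero_add,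
      Finset.sum_eq_single x, map_smul, hf1, smul_eq_mul, mul_one] at h2
    · exact h2
    · intro y _ hne
      rw [map_smul, hf0 _ _ List.Pairwise.nil (Or.inr hne), smul_zero]
    · simp
    · intro k _
      rw [map_sum]
      refine Finset.sum_eq_zero fun l hl => ?_
      rw [map_smul, hf0 _ _ (hpair (Finset.mem_Ioi.mp hl)) (Or.inl (by simp)), smul_zero]

theorem IsTruncatedQDHA.linear_eq_zero [Fintype G] (h : IsTruncatedQDHA G v q κ)
    {W : G → V} (hW : ∑ x, heckeVec v q κ (W x) *
      heckeGroup v q κ (MonoidAlgebra.single x 1) = 0) (x : G) : W x = 0 := by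
  have hw : ∀ (u : V) (x : G), heckeVec v q κ u * heckeGroup v q κ (MonoidAlgebra.single x 1) =
      ∑ i, v.repr u i • heckeWord v q κ [i] x := by
    intro u x
    conv_lhs => rw [← v.sum_repr u]
    simp only [heckeWord, List.map_cons, List.map_nil, List.prod_singleton, map_sum, map_smul,
      Finset.sum_mul, smul_mul_assoc]
  simp only [hw] at hW
  apply v.repr.injective
  ext i
  obtain ⟨f, hf1, hf0⟩ := h.exists_coord (List.pairwise_singleton _ i) x
  have h2 := congrArg f hW
  rw [map_sum, map_zero, Finset.sum_eq_single x, map_sum, Finset.sum_eq_single i, map_smul, hf1,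
    smul_eq_mul, mul_one] at h2
  · rw [h2, map_zero, Finsupp.zero_apply]
  · intro j _ hne
    rw [map_smul, hf0 _ _ (List.pairwise_singleton _ _) (Or.inl (by simp [hne])), smul_zero]
  · simp
  · intro y _ hne
    rw [map_sum]
    refine Finset.sum_eq_zero fun j _ => ?_
    rw [map_smul, hf0 _ _ (List.pairwise_singleton _ _) (Or.inr hne), smul_zero]
  · simp

theorem heckeGroup_mul_heckeVec_eq_sum [Fintype G] (i j : Fin n) (u : V) :
    heckeGroup v q κ (κ (v i) (v j)) * heckeVec v q κ u =
      ∑ x, heckeVec v q κ (kappaCoeff v κ x i j • (x • u)) *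
        heckeGroup v q κ (MonoidAlgebra.single x 1) := by
  rw [eq_sum_smul_single (κ (v i) (v j)), map_sum, Finset.sum_mul]
  refine Finset.sum_congr rfl fun x _ => ?_
  rw [map_smul, smul_mul_assoc, heckeGroup_mul_heckeVec,
    map_smul (heckeVec v q κ) (kappaCoeff v κ x i j), smul_mul_assoc]
  rfl

theorem heckeVec_mul_heckeGroup_eq_sum [Fintype G] (i j : Fin n) (u : V) :
    heckeVec v q κ u * heckeGroup v q κ (κ (v i) (v j)) =
      ∑ x, heckeVec v q κ (kappaCoeff v κ x i j • u) *
        heckeGroup v q κ (MonoidAlgebra.single x 1) := by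
  rw [eq_sum_smul_single (κ (v i) (v j)), map_sum, Finset.mul_sum]
  refine Finset.sum_congr rfl fun x _ => ?_
  rw [map_smul, mul_smul_comm, map_smul, smul_mul_assoc]
  rfl

/-- Exchanging `v_i` and `v_j` twice returns the same product; the coefficients in degree two and
degree zero give the two claims. -/
theorem IsTruncatedQDHA.inv_form_of_lt [Finite G] (h : IsTruncatedQDHA G v q κ)
    {i j : Fin n} (hij : i < j) :
    q j i * q i j = 1 ∧ κ (v j) (v i) = -q j i • κ (v i) (v j) := by
  have h1 := heckeVec_comm (v := v) (q := q) (κ := κ) j i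
  rw [heckeVec_comm i j, smul_add, smul_smul, ← map_smul, add_assoc, ← map_add] at h1
  have h2 := h.quadratic_eq_zero
    (c := fun k l => if k = i ∧ l = j then q j i * q i j - 1 else 0)
    (d := q j i • κ (v i) (v j) + κ (v j) (v i)) (by
      rw [Finset.sum_eq_single i, Finset.sum_eq_single j, if_pos ⟨rfl, rfl⟩, sub_smul, one_smul]
      · rw [sub_add_eq_add_sub, sub_eq_zero]
        exact h1.symm
      · intro l _ hne
        rw [if_neg fun h => hne h.2, zero_smul]
      · simp [hij]
      · intro k _ hne
        exact Finset.sum_eq_zero fun l _ => by rw [if_neg fun h => hne h.1, zero_smul]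
      · simp)
  constructor
  · have := h2.1 i j hij
    rw [if_pos ⟨rfl, rfl⟩] at this
    exact sub_eq_zero.mp this
  · rw [neg_smul]
    exact eq_neg_of_add_eq_zero_right h2.2

theorem IsTruncatedQDHA.inv [Finite G] (h : IsTruncatedQDHA G v q κ) {i j : Fin n} (hij : i ≠ j) :
    q i j = (q j i)⁻¹ := by
  rcases hij.lt_or_gt with hlt | hlt
  · exact eq_inv_of_mul_eq_one_right (h.inv_form_of_lt hlt).1
  · exact eq_inv_of_mul_eq_one_left (h.inv_form_of_lt hlt).1

theorem IsTruncatedQDHA.form [Finite G] (h : IsTruncatedQDHA G v q κ) :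
    IsQuantumTwoForm v q κ := by
  have hself : ∀ i, κ (v i) (v i) = 0 := by
    intro i
    have h1 := heckeVec_comm (v := v) (q := q) (κ := κ) i i
    rw [heckeVec_mul_self, smul_zero, zero_add] at h1
    exact (h.quadratic_eq_zero (c := 0) (d := κ (v i) (v i)) (by simp [← h1])).2
  refine fun i j => ⟨hself i, ?_⟩
  rcases lt_trichotomy i j with hij | rfl | hij
  · rw [← h.inv hij.ne', (h.inv_form_of_lt hij).2]
  · rw [hself, smul_zero]
  · obtain ⟨h1, h2⟩ := h.inv_form_of_lt hij
    rw [h2, smul_smul, neg_mul_neg, inv_mul_cancel₀ (left_ne_zero_of_mul_eq_one h1), one_smul]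

theorem heckeGroup_mul_heckeVec_mul_heckeVec (g : G) (u w : V) :
    heckeGroup v q κ (MonoidAlgebra.single g 1) * (heckeVec v q κ u * heckeVec v q κ w) =
      heckeVec v q κ (g • u) * heckeVec v q κ (g • w) *
        heckeGroup v q κ (MonoidAlgebra.single g 1) := by
  rw [← mul_assoc, heckeGroup_mul_heckeVec, mul_assoc, heckeGroup_mul_heckeVec, mul_assoc]

theorem heckeGroup_single_cancel (g : G) {a b : HeckeAlgebra G v q κ}
    (h : a * heckeGroup v q κ (MonoidAlgebra.single g 1) =
      b * heckeGroup v q κ (MonoidAlgebra.single g 1)) : a = b := by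
  have h1 : heckeGroup v q κ (MonoidAlgebra.single g 1) *
      heckeGroup v q κ (MonoidAlgebra.single g⁻¹ 1) = 1 := by
    rw [← map_mul, MonoidAlgebra.single_mul_single, mul_inv_cancel, one_mul,
      ← MonoidAlgebra.one_def, map_one]
  rw [← mul_one a, ← mul_one b, ← h1, ← mul_assoc, ← mul_assoc, h]

/-- The relator is conjugated by `g` and straightened again: the degree two part gives the minor
equations, the group algebra part the conjugation formula. -/
theorem IsTruncatedQDHA.minor_conj [Finite G] (h : IsTruncatedQDHA G v q κ) (g : G)
    (i j : Fin n) :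
    (∀ k l, k < l → quantumMinor v q g i j l k + q k l * quantumMinor v q g i j k l = 0) ∧
    MonoidAlgebra.single g 1 * κ (v i) (v j) =
      (∑ k, ∑ l ∈ Finset.Ioi k, quantumMinor v q g i j k l • κ (v k) (v l)) *
        MonoidAlgebra.single g 1 := by
  have h1 := congrArg (heckeGroup v q κ (MonoidAlgebra.single g 1) * ·)
    (heckeVec_comm (v := v) (q := q) (κ := κ) i j)
  simp only [mul_add, mul_smul_comm, heckeGroup_mul_heckeVec_mul_heckeVec] at h1
  have hκ : heckeGroup v q κ (MonoidAlgebra.single g 1) * heckeGroup v q κ (κ (v i) (v j)) =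
      heckeGroup v q κ (MonoidAlgebra.single g 1 * κ (v i) (v j) *
        MonoidAlgebra.single g⁻¹ 1) * heckeGroup v q κ (MonoidAlgebra.single g 1) := by
    rw [← map_mul, ← map_mul, mul_assoc _ _ (MonoidAlgebra.single g 1),
      MonoidAlgebra.single_mul_single, inv_mul_cancel, one_mul, ← MonoidAlgebra.one_def, mul_one]
  rw [hκ, ← smul_mul_assoc, ← add_mul] at h1
  have h2 := heckeGroup_single_cancel g h1
  rw [map_smul_mul_map_smul_eq v q, add_right_inj, sum_smul_mul_of_relations (q := q)
    (y := fun k l => heckeGroup v q κ (κ (v k) (v l))) heckeVec_mul_self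
    fun k l _ => heckeVec_comm k l] at h2
  simp only [Finset.sum_add_distrib, ← map_smul (heckeGroup v q κ),
    ← map_sum (heckeGroup v q κ)] at h2
  obtain ⟨h3, h4⟩ := h.quadratic_eq_zero
    (c := fun k l => quantumMinor v q g i j l k + q k l * quantumMinor v q g i j k l)
    (d := ∑ k, ∑ l ∈ Finset.Ioi k, quantumMinor v q g i j k l • κ (v k) (v l) -
      MonoidAlgebra.single g 1 * κ (v i) (v j) * MonoidAlgebra.single g⁻¹ 1)
    (by rw [map_sub, ← h2]; simp)
  refine ⟨h3, ?_⟩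
  rw [sub_eq_zero.mp h4, mul_assoc _ _ (MonoidAlgebra.single g 1),
    MonoidAlgebra.single_mul_single, inv_mul_cancel, one_mul, ← MonoidAlgebra.one_def, mul_one]

theorem IsTruncatedQDHA.sq_square [Finite G] (h : IsTruncatedQDHA G v q κ) (g : G)
    (i : Fin n) :
    (∀ k l, k < l →
      entry v g k i * entry v g l i + q k l * (entry v g l i * entry v g k i) = 0) ∧
    ∑ k, ∑ l ∈ Finset.Ioi k, (entry v g k i * entry v g l i) • κ (v k) (v l) = 0 := by
  have h1 := congrArg (heckeGroup v q κ (MonoidAlgebra.single g 1) * ·)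
    (heckeVec_mul_self (v := v) (q := q) (κ := κ) i)
  simp only [heckeGroup_mul_heckeVec_mul_heckeVec, mul_zero] at h1
  rw [← zero_mul (heckeGroup v q κ (MonoidAlgebra.single g 1))] at h1
  have h2 := heckeGroup_single_cancel g h1
  rw [map_smul_mul_map_smul, sum_smul_mul_of_relations (q := q)
    (y := fun k l => heckeGroup v q κ (κ (v k) (v l))) heckeVec_mul_self
    fun k l _ => heckeVec_comm k l] at h2
  simp only [Finset.sum_add_distrib, ← map_smul (heckeGroup v q κ),
    ← map_sum (heckeGroup v q κ)] at h2
  obtain ⟨h3, h4⟩ := h.quadratic_eq_zero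
    (c := fun k l => entry v g k i * entry v g l i + q k l * (entry v g l i * entry v g k i))
    (d := ∑ k, ∑ l ∈ Finset.Ioi k, (entry v g l i * entry v g k i) • κ (v k) (v l)) h2
  refine ⟨h3, ?_⟩
  rw [← h4]
  exact Finset.sum_congr rfl fun k _ => Finset.sum_congr rfl fun l _ => by rw [mul_comm]

theorem heckeGroup_kappa (i j : Fin n) : heckeGroup v q κ (κ (v i) (v j)) =
    heckeVec v q κ (v j) * heckeVec v q κ (v i) -
      q i j • (heckeVec v q κ (v i) * heckeVec v q κ (v j)) :=
  eq_sub_of_add_eq' (heckeVec_comm i j).symm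

/-- Once each `κ` is written as a twisted commutator, the combination cancels formally in any
associative algebra. Moving group elements to the right turns it into an identity of degree one,
whose coefficients are compared. -/
theorem IsTruncatedQDHA.jacobi [Finite G] (h : IsTruncatedQDHA G v q κ) (g : G)
    (i j k : Fin n) :
    0 = kappaCoeff v κ g i j • ((q i k * q j k) • (g • v k) - v k)
      + kappaCoeff v κ g i k • (q j k • v j - q i j • (g • v j))
      + kappaCoeff v κ g j k • (g • v i - (q i j * q i k) • v i) := by
  have := Fintype.ofFinite G
  refine (h.linear_eq_zero (W := fun g =>
    kappaCoeff v κ g i j • ((q i k * q j k) • (g • v k) - v k)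
      + kappaCoeff v κ g i k • (q j k • v j - q i j • (g • v j))
      + kappaCoeff v κ g j k • (g • v i - (q i j * q i k) • v i)) ?_ g).symm
  have h1 : (q i k * q j k) • (heckeGroup v q κ (κ (v i) (v j)) * heckeVec v q κ (v k))
      - heckeVec v q κ (v k) * heckeGroup v q κ (κ (v i) (v j))
      + (q j k • (heckeVec v q κ (v j) * heckeGroup v q κ (κ (v i) (v k)))
      - q i j • (heckeGroup v q κ (κ (v i) (v k)) * heckeVec v q κ (v j)))
      + (heckeGroup v q κ (κ (v j) (v k)) * heckeVec v q κ (v i)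
      - (q i j * q i k) • (heckeVec v q κ (v i) * heckeGroup v q κ (κ (v j) (v k)))) = 0 := by
    simp only [heckeGroup_kappa, mul_sub, sub_mul, mul_smul_comm, smul_mul_assoc, mul_assoc]
    module
  rw [← h1]
  simp only [heckeGroup_mul_heckeVec_eq_sum, heckeVec_mul_heckeGroup_eq_sum, Finset.smul_sum,
    ← Finset.sum_sub_distrib, ← Finset.sum_add_distrib]
  refine Finset.sum_congr rfl fun x _ => ?_
  simp only [map_add, map_sub, map_smul, smul_sub, add_mul, sub_mul, smul_mul_assoc]
  module

/-- These are the overlaps with a repeated letter: the terms containing `v_i ^ 2` or `v_j ^ 2`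
vanish, and the words `v_i v_j v_i`, respectively `v_j v_i v_j`, cancel. -/
theorem IsTruncatedQDHA.double [Finite G] (h : IsTruncatedQDHA G v q κ) (g : G)
    (i j : Fin n) :
    0 = (q i j * kappaCoeff v κ g i j) • v i + kappaCoeff v κ g i j • (g • v i) ∧
    0 = (q i j * kappaCoeff v κ g i j) • (g • v j) + kappaCoeff v κ g i j • v j := by
  have := Fintype.ofFinite G
  have hsq : ∀ (i : Fin n) (z : HeckeAlgebra G v q κ),
      heckeVec v q κ (v i) * (heckeVec v q κ (v i) * z) = 0 := fun i z => by
    rw [← mul_assoc, heckeVec_mul_self, zero_mul]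
  constructor
  · refine (h.linear_eq_zero (W := fun g => (q i j * kappaCoeff v κ g i j) • v i +
      kappaCoeff v κ g i j • (g • v i)) ?_ g).symm
    have h1 : q i j • (heckeVec v q κ (v i) * heckeGroup v q κ (κ (v i) (v j))) +
        heckeGroup v q κ (κ (v i) (v j)) * heckeVec v q κ (v i) = 0 := by
      simp only [heckeGroup_kappa, mul_sub, sub_mul, mul_smul_comm, smul_mul_assoc, mul_assoc,
        hsq, heckeVec_mul_self, mul_zero]
      module
    rw [← h1]
    simp only [heckeGroup_mul_heckeVec_eq_sum, heckeVec_mul_heckeGroup_eq_sum, Finset.smul_sum,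
      ← Finset.sum_add_distrib]
    refine Finset.sum_congr rfl fun x _ => ?_
    simp only [map_add, map_smul, add_mul, smul_mul_assoc, smul_smul]
  · refine (h.linear_eq_zero (W := fun g => (q i j * kappaCoeff v κ g i j) • (g • v j) +
      kappaCoeff v κ g i j • v j) ?_ g).symm
    have h1 : q i j • (heckeGroup v q κ (κ (v i) (v j)) * heckeVec v q κ (v j)) +
        heckeVec v q κ (v j) * heckeGroup v q κ (κ (v i) (v j)) = 0 := by
      simp only [heckeGroup_kappa, mul_sub, sub_mul, mul_smul_comm, smul_mul_assoc, mul_assoc,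
        hsq, heckeVec_mul_self, mul_zero]
      module
    rw [← h1]
    simp only [heckeGroup_mul_heckeVec_eq_sum, heckeVec_mul_heckeGroup_eq_sum, Finset.smul_sum,
      ← Finset.sum_add_distrib]
    refine Finset.sum_congr rfl fun x _ => ?_
    simp only [map_add, map_smul, add_mul, smul_mul_assoc, smul_smul]

theorem IsTruncatedQDHA.heckeConditions [Finite G] (h : IsTruncatedQDHA G v q κ) :
    HeckeConditions G v q κ where
  inv _ _ hij := h.inv hij
  minor g i j k l _ hkl := (h.minor_conj g i j).1 k l hkl
  sq g i k l hkl := (h.sq_square g i).1 k l hkl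
  form := h.form
  jacobi g i j k _ _ := h.jacobi g i j k
  conj g i j _ := (h.minor_conj g i j).2
  double g i j _ := h.double g i j
  square g r := (h.sq_square g r).2

theorem isTruncatedQDHA_iff_heckeConditions [Finite G] (hq : ∀ i j, q i j ≠ 0)
    (hK : (2 : K) ≠ 0) : IsTruncatedQDHA G v q κ ↔ HeckeConditions G v q κ :=
  ⟨fun h => h.heckeConditions,
    fun H => ⟨H.linearIndependent hq hK, (H.diagonalSupport hq).span_pbwMonomial⟩⟩

end Necessity

/-! ### Condition (i) as equations on matrix entries. -/

section ExteriorAction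

variable {K V : Type*} [Field K] [AddCommGroup V] [Module K V] {n : ℕ}
  {G : Subgroup (LinearMap.GeneralLinearGroup K V)}
  {v : Module.Basis (Fin n) K V} {q : Fin n → Fin n → K}

/-- `extVec` as a linear map. -/
def extVecHom (v : Module.Basis (Fin n) K V) (q : Fin n → Fin n → K) :
    V →ₗ[K] QuantumExterior v q :=
  (mkExterior v q).toLinearMap ∘ₗ TensorAlgebra.ι K

theorem extVecHom_apply (u : V) : extVecHom v q u = extVec v q u := rfl

theorem extVec_mul_self (i : Fin n) : extVecHom v q (v i) * extVecHom v q (v i) = 0 := by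
  have h := RingQuot.mkAlgHom_rel K (ExteriorRel.sq (v := v) (q := q) i)
  rw [map_pow, map_zero, sq] at h
  exact h

theorem extVec_comm {i j : Fin n} (hij : i ≠ j) : extVecHom v q (v j) * extVecHom v q (v i) =
    q i j • (extVecHom v q (v i) * extVecHom v q (v j)) := by
  have h := RingQuot.mkAlgHom_rel K (ExteriorRel.comm (v := v) (q := q) i j hij)
  rw [map_smul, map_mul, map_mul] at h
  exact h

/-- The universal property of the quantum exterior algebra. -/
theorem exists_quantumExterior_lift {B : Type*} [Semiring B] [Algebra K B] (x : V →ₗ[K] B)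
    (hcomm : ∀ i j, i ≠ j → x (v j) * x (v i) = q i j • (x (v i) * x (v j)))
    (hsq : ∀ i, x (v i) * x (v i) = 0) :
    ∃ f : QuantumExterior v q →ₐ[K] B, ∀ u, f (extVec v q u) = x u := by
  have h : ∀ ⦃a b⦄, ExteriorRel v q a b → TensorAlgebra.lift K x a = TensorAlgebra.lift K x b := by
    rintro _ _ (⟨i, j, hij⟩ | i)
    · simp only [map_mul, map_smul, TensorAlgebra.lift_ι_apply, hcomm i j hij]
    · rw [sq, map_mul, TensorAlgebra.lift_ι_apply, hsq, map_zero]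
  refine ⟨RingQuot.liftAlgHom K ⟨TensorAlgebra.lift K x, h⟩, fun u => ?_⟩
  exact (RingQuot.liftAlgHom_mkAlgHom_apply K _ h _).trans (TensorAlgebra.lift_ι_apply _ _)

theorem quantumExterior_hom_ext {B : Type*} [Semiring B] [Algebra K B]
    {f f' : QuantumExterior v q →ₐ[K] B} (h : ∀ u, f (extVec v q u) = f' (extVec v q u)) :
    f = f' := by
  have h1 : f.comp (mkExterior v q) = f'.comp (mkExterior v q) :=
    TensorAlgebra.hom_ext (LinearMap.ext h)
  refine AlgHom.ext fun z => ?_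
  obtain ⟨z, rfl⟩ := RingQuot.mkAlgHom_surjective K (ExteriorRel v q) z
  exact DFunLike.congr_fun h1 z

/-- Independence of the products `v_k v_l`, `k < l`, is detected by letting the exterior algebra act
through creation operators and evaluating on the vacuum, where distinct pairs give distinct basis
vectors. -/
theorem extVec_quadratic_eq_zero (hinv : ∀ i j, i ≠ j → q i j = (q j i)⁻¹)
    (hq : ∀ i j, q i j ≠ 0) {c : Fin n → Fin n → K}
    (hc : ∑ k, ∑ l ∈ Finset.Ioi k, c k l • (extVecHom v q (v k) * extVecHom v q (v l)) = 0)
    {k l : Fin n} (hkl : k < l) : c k l = 0 := by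
  have hQ : ∀ i j, fermionic q i j * fermionic q j i = 1 := by
    intro i j
    rcases eq_or_ne i j with rfl | h
    · simp [fermionic]
    · rw [fermionic_of_ne h, fermionic_of_ne h.symm, hinv i j h, inv_mul_cancel₀ (hq j i)]
  obtain ⟨f, hf⟩ := exists_quantumExterior_lift (v := v) (q := q)
    (v.constr K (creation (fermionic q)))
    (fun i j hij => by
      rw [Module.Basis.constr_basis, Module.Basis.constr_basis, creation_mul_creation hQ,
        fermionic_of_ne hij])
    (fun i => by
      rw [Module.Basis.constr_basis]
      refine Finsupp.lhom_ext fun A a => ?_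
      rw [Module.End.mul_apply, LinearMap.zero_apply]
      by_cases hi : i ∈ A
      · rw [creation_single_of_mem _ hi, map_zero]
      · rw [creation_single _ hi, creation_single_of_mem _ (Finset.mem_insert_self _ _)])
  have h1 := congrArg (fun z => f z (Finsupp.single ∅ 1) {k, l}) hc
  simp only [map_sum, map_smul, map_mul, extVecHom_apply, hf, Module.Basis.constr_basis, map_zero,
    LinearMap.sum_apply, LinearMap.smul_apply, Module.End.mul_apply, LinearMap.zero_apply,
    Finsupp.zero_apply, Finsupp.finsetSum_apply, Finsupp.smul_apply] at h1
  have h2 : ∀ i j : Fin n, i < j → creation (fermionic q) i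
      (creation (fermionic q) j (Finsupp.single ∅ 1)) = Finsupp.single {i, j} 1 := by
    intro i j hij
    rw [creation_single _ (Finset.notMem_empty _), creation_single _ (by simp [hij.ne])]
    simp [hij.not_gt]
  have h3 : ∀ i j : Fin n, i < j → ¬ (i = k ∧ j = l) → ({i, j} : Finset (Fin n)) ≠ {k, l} := by
    intro i j hij hne he
    have hk := (Finset.ext_iff.mp he k).mpr (by simp)
    have hl := (Finset.ext_iff.mp he l).mpr (by simp)
    have hi := (Finset.ext_iff.mp he i).mp (by simp)
    have hj := (Finset.ext_iff.mp he j).mp (by simp)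
    simp only [Finset.mem_insert, Finset.mem_singleton, Fin.ext_iff] at hk hl hi hj hne
    omega
  rw [Finset.sum_eq_single k, Finset.sum_eq_single l, h2 k l hkl, Finsupp.single_eq_same,
    smul_eq_mul, mul_one] at h1
  · exact h1
  · intro j hj hne
    have hkj := Finset.mem_Ioi.mp hj
    rw [h2 k j hkj, Finsupp.single_eq_of_ne (h3 k j hkj fun h => hne h.2).symm, smul_zero]
  · simp [hkl]
  · intro i _ hne
    refine Finset.sum_eq_zero fun j hj => ?_
    have hij := Finset.mem_Ioi.mp hj
    rw [h2 i j hij, Finsupp.single_eq_of_ne (h3 i j hij fun h => hne h.1).symm, smul_zero]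
  · simp

theorem ActsByAutomorphisms.preservesExteriorRel (h : ActsByAutomorphisms G v q)
    (hinv : ∀ i j, i ≠ j → q i j = (q j i)⁻¹) (hq : ∀ i j, q i j ≠ 0) :
    PreservesExteriorRel G v q := by
  obtain ⟨ρ, hρ⟩ := h
  have hρ' : ∀ (g : G) (u : V), ρ g (extVecHom v q u) = extVecHom v q (g • u) := hρ
  refine ⟨hinv, fun g i j k l hij hkl => ?_, fun g i k l hkl => ?_⟩
  · have h1 := congrArg (ρ g) (extVec_comm (v := v) (q := q) hij.ne)
    rw [map_smul, map_mul, map_mul, hρ', hρ', map_smul_mul_map_smul_eq v q, add_eq_left,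
      sum_smul_mul_of_relations (q := q) (y := fun _ _ => 0) extVec_mul_self
        fun k l hkl => by rw [extVec_comm hkl.ne, add_zero]] at h1
    simp only [smul_zero, add_zero] at h1
    exact extVec_quadratic_eq_zero hinv hq h1 hkl
  · have h1 := congrArg (ρ g) (extVec_mul_self (v := v) (q := q) i)
    rw [map_mul, hρ', map_zero, map_smul_mul_map_smul,
      sum_smul_mul_of_relations (q := q) (y := fun _ _ => 0) extVec_mul_self
        fun k l hkl => by rw [extVec_comm hkl.ne, add_zero]] at h1
    simp only [smul_zero, add_zero] at h1
    exact extVec_quadratic_eq_zero hinv hq h1 hkl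

/-- The equations make each `g` descend to an algebra endomorphism. Since these agree on generators
with composition in `G`, the endomorphism of `g⁻¹` is inverse to that of `g`. -/
theorem PreservesExteriorRel.actsByAutomorphisms (H : PreservesExteriorRel G v q)
    (hq : ∀ i j, q i j ≠ 0) : ActsByAutomorphisms G v q := by
  have hcomm : ∀ (g : G) (i j : Fin n), i < j →
      extVecHom v q (g • v j) * extVecHom v q (g • v i) =
        q i j • (extVecHom v q (g • v i) * extVecHom v q (g • v j)) := by
    intro g i j hij
    rw [map_smul_mul_map_smul_eq v q, add_eq_left,
      sum_smul_mul_of_relations (q := q) (y := fun _ _ => 0) extVec_mul_self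
        fun k l hkl => by rw [extVec_comm hkl.ne, add_zero]]
    refine Finset.sum_eq_zero fun k _ => Finset.sum_eq_zero fun l hl => ?_
    rw [H.minor g i j k l hij (Finset.mem_Ioi.mp hl), zero_smul, smul_zero, add_zero]
  have hsq : ∀ (g : G) (i : Fin n),
      extVecHom v q (g • v i) * extVecHom v q (g • v i) = 0 := by
    intro g i
    rw [map_smul_mul_map_smul,
      sum_smul_mul_of_relations (q := q) (y := fun _ _ => 0) extVec_mul_self
        fun k l hkl => by rw [extVec_comm hkl.ne, add_zero]]
    refine Finset.sum_eq_zero fun k _ => Finset.sum_eq_zero fun l hl => ?_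
    rw [H.sq g i k l (Finset.mem_Ioi.mp hl), zero_smul, smul_zero, add_zero]
  have hex : ∀ g : G, ∃ f : QuantumExterior v q →ₐ[K] QuantumExterior v q,
      ∀ u, f (extVec v q u) = extVec v q (g • u) := fun g =>
    exists_quantumExterior_lift (extVecHom v q ∘ₗ
        ((g : LinearMap.GeneralLinearGroup K V) : V →ₗ[K] V))
      (fun i j hij => by
        rcases hij.lt_or_gt with h | h
        · exact hcomm g i j h
        · have := hcomm g j i h
          change extVecHom v q (g • v j) * extVecHom v q (g • v i) =
            q i j • (extVecHom v q (g • v i) * extVecHom v q (g • v j))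
          rw [this, smul_smul, H.inv i j hij, inv_mul_cancel₀ (hq j i), one_smul])
      (fun i => hsq g i)
  choose f hf using hex
  have hmul : ∀ g h : G, f (g * h) = (f g).comp (f h) := fun g h =>
    quantumExterior_hom_ext fun u => by rw [AlgHom.comp_apply, hf, hf, hf, mul_smul]
  have hone : f 1 = AlgHom.id K _ :=
    quantumExterior_hom_ext fun u => by rw [hf, one_smul, AlgHom.id_apply]
  refine ⟨{
    toFun := fun g => AlgEquiv.ofAlgHom (f g) (f g⁻¹)
      (by rw [← hmul, mul_inv_cancel, hone]) (by rw [← hmul, inv_mul_cancel, hone])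
    map_one' := AlgEquiv.ext fun z => DFunLike.congr_fun hone z
    map_mul' := fun g h => AlgEquiv.ext fun z => DFunLike.congr_fun (hmul g h) z }, hf⟩

theorem preservesExteriorRel_iff (hq : ∀ i j, q i j ≠ 0) : PreservesExteriorRel G v q ↔
    ActsByAutomorphisms G v q ∧ ∀ i j, i ≠ j → q i j = (q j i)⁻¹ :=
  ⟨fun H => ⟨H.actsByAutomorphisms hq, H.inv⟩, fun h => h.1.preservesExteriorRel h.2 hq⟩

end ExteriorAction

end

end TruncatedQDHA

open TruncatedQDHA

theorem mainTheorem1 {K V : Type*} [Field K] [AddCommGroup V] [Module K V] {n : ℕ}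
    (v : Module.Basis (Fin n) K V) (G : Subgroup (LinearMap.GeneralLinearGroup K V)) [Finite G]
    (hK : ringChar K ≠ 2) (hG : ¬ ringChar K ∣ Nat.card G)
    (q : Fin n → Fin n → K) (hq : ∀ i j, q i j ≠ 0)
    (κ : V →ₗ[K] V →ₗ[K] MonoidAlgebra K G) :
    IsTruncatedQDHA G v q κ ↔
      (ActsByAutomorphisms G v q ∧ ∀ i j, i ≠ j → q i j = (q j i)⁻¹) ∧
      IsQuantumTwoForm v q κ ∧
      (∀ (h : G) (i j k : Fin n), i < j → j < k →
        0 = kappaCoeff v κ h i j • ((q i k * q j k) • (h • v k) - v k)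
          + kappaCoeff v κ h i k • (q j k • v j - q i j • (h • v j))
          + kappaCoeff v κ h j k • (h • v i - (q i j * q i k) • v i)) ∧
      (∀ (g h : G) (r s : Fin n), r < s →
        kappaCoeff v κ (h⁻¹ * g * h) r s =
          ∑ i, ∑ j ∈ Finset.Ioi i, quantumMinor v q h r s i j * kappaCoeff v κ g i j) ∧
      (∀ (h : G) (i j : Fin n), i < j →
        0 = (q i j * kappaCoeff v κ h i j) • v i + kappaCoeff v κ h i j • (h • v i) ∧
        0 = (q i j * kappaCoeff v κ h i j) • (h • v j) + kappaCoeff v κ h i j • v j) ∧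
      (∀ (g h : G) (r : Fin n),
        ∑ i, ∑ j ∈ Finset.Ioi i, entry v g i r * entry v g j r * kappaCoeff v κ h i j = 0) := by
  rw [isTruncatedQDHA_iff_heckeConditions hq (Ring.two_ne_zero hK), ← preservesExteriorRel_iff hq,
    ← conj_iff, ← square_iff]
  exact ⟨fun H => ⟨H.toPreservesExteriorRel, H.form, H.jacobi, H.conj, H.double, H.square⟩,
    fun ⟨h1, h2, h3, h4, h5, h6⟩ => ⟨h1, h2, h3, h4, h5, h6⟩⟩
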